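/- **Setting.** Let $K$ be a linearly ordered set of keys, extended by $-\infty,+\infty$. A directed graph is stored in sequentially consistent shared memory as a sorted singly linked list of vertex nodes (fields: immutable key `val`, `vnext`, Boolean `marked`, a lock, and the sentinels `EdgeHead`, `EdgeTail` of an edge list). It starts at the sentinel `VertexHead` with key $-\infty$ and ends in a sentinel with key $+\infty$. The edge list of a vertex node is a sorted singly linked list of edge nodes (fields: immutable key `val`, `enext`, `status` $\in\{\text{transit},\text{marked},\text{added}\}$, a lock) from a sentinel with key $-\infty$ to a sentinel with key $+\infty$; sentinel edge nodes are created with a fixed status $\sigma\ne\text{marked}$, all other edge nodes with status transit. Initially the vertex list consists of its two sentinels only (the empty graph). An arbitrary family of threads repeatedly and concurrently invokes the following methods with arbitrary keys. Each atomic event is at most one read or write of a mutable field, lock acquisition, lock release or node allocation; an execution is any finite interleaving of such events. Node references are never reused. * *Searches without locks* follow the list while the key of the current node is smaller than the given key $k$. A search in the vertex list succeeds if the node where it stops has key $k$ and is then read as unmarked. *HelpSearchEdge*$(u,v)$ searches the vertex list for the smaller of the keys $u,v$ from `VertexHead`, then for the larger one from the vertex node found, and fails if one of the searches fails. * *AddVertex*$(k)$,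 *RemoveVertex*$(k)$: search the vertex list without locks for adjacent nodes $v_1,v_2$ with $v_1.val<k\le v_2.val$, lock $v_1$, then $v_2$, and validate that both are unmarked and $v_1.vnext=v_2$ (otherwise unlock and retry). Then, respectively, insert a new vertex node with key $k$ and empty edge list between them if $v_2.val\neq k$; or, if $v_2.val=k$, first mark $v_2$ and then set $v_1.vnext:=v_2.vnext$. Unlock. *ContainsVertex*$(k)$ is the search described above. * *AcyclicLocateEdge*$(u,v)$: call *HelpSearchEdge*$(u,v)$ and then check again that neither of the two vertex nodes found is marked (otherwise fail). Search the edge list of the vertex node found for $u$ without locks for adjacent edge nodes $e_1,e_2$ with $e_1.val<v\le e_2.val$, lock $e_1$, then $e_2$, and validate; if validation fails, unlock and search the edge list again. When called by *AcyclicAddEdge*, validation means $e_1.status\ne\text{marked}$, $e_2.status\neq\text{marked}$ and $e_1.enext=e_2$; when called by *AcyclicRemoveEdge*, it means $e_1.status=e_2.status=\text{added}$ and $e_1.enext=e_2$. * *AcyclicAddEdge*$(u,v)$: call *AcyclicLocateEdge*$(u,v)$. If it fails, return false. If $e_2.val=v$, unlock and return true. Otherwise insert a new edge node $e_3$ with key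 $v$ and status transit between $e_1$ and $e_2$, unlock, and call *PathExists*$(v,u)$. If this returns false, set $e_3.status:=\text{added}$ and return true. If it returns true, locate, lock and validate (only unmarkedness and adjacency) adjacent edge nodes $ne_1,ne_2$ with $ne_1.val<v\le ne_2.val$ in the same edge list, retrying if necessary; set $e_3.status:=\text{marked}$, then $ne_1.enext:=ne_2.enext$, unlock $ne_1,ne_2$ and return false. * *AcyclicRemoveEdge*$(u,v)$: call *AcyclicLocateEdge*$(u,v)$; if it succeeds and $e_2.val=v$, set $e_2.status:=\text{marked}$, then $e_1.enext:=e_2.enext$; unlock. *AcyclicContainsEdge*$(u,v)$: call *HelpSearchEdge*$(u,v)$, then search the edge list of the vertex node found for $u$ without locks for an edge node with key $v$ and status added. * *PathExists*$(v,u)$: without locks, keep a local set $R$ of keys, initially empty. Search the vertex list for $v$ (return false on failure), traverse the edge list of the node found and add to $R$ the key of every edge node not read as marked (the final sentinel is not visited); if $u\in R$ return true, otherwise flag $v$ as explored. While some $x\in R$ is not explored: search the vertex list for $x$; on success traverse its edge list in the same way and return true if then $u\in R$; flag $x$ as explored. When every element of $R$ is explored, return false. **Abstract graph.** In a global state $S$,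 the vertices of the abstract graph are the keys $k\in K$ of the unmarked vertex nodes reachable from `VertexHead`. A pair $(k,l)$ of such vertices is an *added* edge if an edge node with key $l$ and status added is reachable from the `EdgeHead` of an unmarked vertex node with key $k$ that is reachable from `VertexHead`. **Lemma.** In every global state $S$ of every concurrent execution, the added edges of the abstract graph contain no directed cycle (in particular no loop). -/

import Mathlib

/-! Concurrent directed graph: a sorted linked list of vertex nodes, each carrying a sorted linked
list of edge nodes, both maintained by fine-grained locking with lazy deletion.  Shared memory is
sequentially consistent; every step of a thread performs at most one access to a mutable shared
field (a read, a write, a lock acquisition or a lock release). -/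

namespace AcyclicGraph

/-! ## Shared memory -/

/-- References to vertex nodes. -/
abbrev VRef := ℕ

/-- References to edge nodes. -/
abbrev ERef := ℕ

/-- Values of the `val` fields: application keys together with `-∞ = ⊥` and `+∞ = ⊤`. -/
abbrev Val (K : Type*) := WithBot (WithTop K)

/-- An application key as a field value. -/
def toVal {K : Type*} (k : K) : Val K := ((k : WithTop K) : WithBot (WithTop K))

inductive EStatus
  | transit
  | marked
  | added

/-- Edge nodes.  `enext = none` is the null pointer, `lock` holds the owner of the lock. -/
structure ENode (K T : Type*) where
  val : Val K
  enext : Option ERef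
  status : EStatus
  lock : Option T

/-- Vertex nodes. -/
structure VNode (K T : Type*) where
  val : Val K
  vnext : Option VRef
  edgeHead : ERef
  edgeTail : ERef
  marked : Bool
  lock : Option T

/-- The shared heap; `none` means that the reference has not been allocated. -/
structure Heap (K T : Type*) where
  vnode : VRef → Option (VNode K T)
  enode : ERef → Option (ENode K T)

namespace Heap

variable {K T : Type*}

/-- Store an edge node. -/
def setE (h : Heap K T) (e : ERef) (n : ENode K T) : Heap K T :=
  { h with enode := Function.update h.enode e (some n) }

/-- Store a vertex node. -/
def setV (h : Heap K T) (v : VRef) (n : VNode K T) : Heap K T :=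
  { h with vnode := Function.update h.vnode v (some n) }

/-- The constructor `new enode(key)`. -/
def newE (h : Heap K T) (e : ERef) (key : Val K) : Heap K T :=
  h.setE e { val := key, enext := none, status := .transit, lock := none }

/-- The constructor `new vnode(key)`: the new vertex node `v` gets an edge list that consists of the
two sentinels `eh` and `et`, whose status is `σ`. -/
def newV (σ : EStatus) (h : Heap K T) (v : VRef) (eh et : ERef) (key : Val K) : Heap K T :=
  ((h.setE et { val := ⊤, enext := none, status := σ, lock := none }).setE eh
      { val := ⊥, enext := some et, status := σ, lock := none }).setV v
    { val := key, vnext := none, edgeHead := eh, edgeTail := et, marked := false, lock := none }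

end Heap

/-- The global variable `VertexHead`: the sentinel with key `-∞`, never reassigned. -/
def vertexHead : VRef := 0

/-- The sentinel with key `+∞` that ends the vertex list. -/
def vertexTail : VRef := 1

/-- The empty graph: the vertex list consists of the two sentinels. -/
def initHeap (K T : Type*) (σ : EStatus) : Heap K T :=
  let h₀ : Heap K T := { vnode := fun _ => none, enode := fun _ => none }
  let h₁ := (h₀.newV σ vertexTail 2 3 ⊤).newV σ vertexHead 0 1 ⊥
  h₁.setV vertexHead
    { val := ⊥, vnext := some vertexTail, edgeHead := 0, edgeTail := 1,
      marked := false, lock := none }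

/-! ## Control states of a thread -/

/-- The update methods on vertices. -/
inductive VMethod
  | add
  | rem

/-- The methods on edges. -/
inductive EMethod
  | add
  | rem
  | con

/-- Local variables of an `AcyclicAddEdge(key1, key2)` that has inserted its edge node `e3` into
the edge list of `v1`. -/
structure AddCtx (K : Type*) where
  key1 : K
  key2 : K
  v1 : VRef
  v2 : VRef
  e3 : ERef

/-- Local variables of `PathExists(key2, key1)`, called by `AcyclicAddEdge(key1, key2)`: the set
`local_R` and the set of the keys whose `explored` flag is set. -/
structure PathCtx (K : Type*) where
  ctx : AddCtx K
  localR : Set (Val K)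
  explored : Set (Val K)

/-- Return points of a lock-free search in the vertex list. -/
inductive VCont (K : Type*)
  /-- `ContainsVertex` -/
  | contains
  /-- first search of `HelpSearchEdge(key1, key2)` -/
  | helpFst (m : EMethod) (key1 key2 : K)
  /-- second search of `HelpSearchEdge(key1, key2)`; the first one returned `v` -/
  | helpSnd (m : EMethod) (key1 key2 : K) (v : VRef)
  /-- search of `PathExists` for its source vertex -/
  | pathSrc (c : AddCtx K)
  /-- search of `PathExists` for the vertex with the key `kx` taken from `local_R` -/
  | pathKey (p : PathCtx K) (kx : Val K)

/-- Calls that locate and lock two adjacent edge nodes. -/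
inductive LCont (K : Type*)
  /-- `AcyclicLocateEdge` with `val = true`, called by `AcyclicAddEdge` -/
  | add (key1 key2 : K) (v1 v2 : VRef)
  /-- `AcyclicLocateEdge` with `val = false`, called by `AcyclicRemoveEdge` -/
  | rem (key1 key2 : K) (v1 v2 : VRef)
  /-- `NewLocateEdge`, called by `AcyclicAddEdge` after a cycle was detected -/
  | new (c : AddCtx K)

namespace LCont

variable {K : Type*}

/-- The key that is searched for in the edge list. -/
def key : LCont K → K
  | .add _ key2 _ _ => key2
  | .rem _ key2 _ _ => key2
  | .new c => c.key2

/-- The vertex node whose edge list is searched. -/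
def src : LCont K → VRef
  | .add _ _ v1 _ => v1
  | .rem _ _ v1 _ => v1
  | .new c => c.v1

/-- The condition on the status of the two locked nodes: `AcyclicValidateEdge` requires `added`,
`ModifiedValidateEdge` only forbids `marked`. -/
def Valid : LCont K → EStatus → Prop
  | .rem _ _ _ _, s => s = .added
  | _, s => s ≠ .marked

end LCont

/-- What follows the release of the locks on two edge nodes. -/
inductive ERel (K : Type*)
  /-- validation failed: search again -/
  | retry (κ : LCont K)
  /-- call `PathExists` -/
  | path (c : AddCtx K)
  /-- return the flag -/
  | ret (flag : Bool)

/-- What follows the release of the locks on two vertex nodes. -/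
inductive VRel (K : Type*)
  | retry (m : VMethod) (key : K)
  | ret (flag : Bool)

/-- Control states: a program point with the values of its live local variables. -/
inductive PC (K : Type*)
  /-- outside every method -/
  | idle
  /-- about to return the flag to the caller -/
  | ret (flag : Bool)
  -- Search in the vertex list without locks.
  | vTest (κ : VCont K) (key : Val K) (v : VRef)
  | vNext (κ : VCont K) (key : Val K) (v : VRef)
  | vCheckVal (κ : VCont K) (key : Val K) (v : VRef)
  | vCheckMark (κ : VCont K) (v : VRef)
  -- `LocateVertex`, `ValidateVertex`, `AddVertex`, `RemoveVertex`
  | vlStart (m : VMethod) (key : K)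
  | vlTest (m : VMethod) (key : K) (v1 v2 : VRef)
  | vlNext (m : VMethod) (key : K) (v1 v2 : VRef)
  | vlAcq1 (m : VMethod) (key : K) (v1 v2 : VRef)
  | vlAcq2 (m : VMethod) (key : K) (v1 v2 : VRef)
  | vlVal1 (m : VMethod) (key : K) (v1 v2 : VRef)
  | vlVal2 (m : VMethod) (key : K) (v1 v2 : VRef)
  | vlVal3 (m : VMethod) (key : K) (v1 v2 : VRef)
  | vlDone (m : VMethod) (key : K) (v1 v2 : VRef)
  | vaNew (key : K) (v1 v2 : VRef)
  | vaLink (v1 v2 v3 : VRef)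
  | vaInsert (v1 v2 v3 : VRef)
  | vrMark (v1 v2 : VRef)
  | vrRead (v1 v2 : VRef)
  | vrUnlink (v1 v2 : VRef) (w : Option VRef)
  | vRel1 (ρ : VRel K) (v1 v2 : VRef)
  | vRel2 (ρ : VRel K) (v2 : VRef)
  -- The test of `v1.marked` and `v2.marked` in `AcyclicLocateEdge`.
  | mark1 (κ : LCont K) (v1 v2 : VRef)
  | mark2 (κ : LCont K) (v2 : VRef)
  -- The main loop of `AcyclicLocateEdge` and of `NewLocateEdge`.
  | lStart (κ : LCont K)
  | lFirst (κ : LCont K) (e1 : ERef)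
  | lTest (κ : LCont K) (e1 e2 : ERef)
  | lNext (κ : LCont K) (e1 e2 : ERef)
  | lAcq1 (κ : LCont K) (e1 e2 : ERef)
  | lAcq2 (κ : LCont K) (e1 e2 : ERef)
  | lVal1 (κ : LCont K) (e1 e2 : ERef)
  | lVal2 (κ : LCont K) (e1 e2 : ERef)
  | lVal3 (κ : LCont K) (e1 e2 : ERef)
  | eRel1 (ρ : ERel K) (e1 e2 : ERef)
  | eRel2 (ρ : ERel K) (e2 : ERef)
  -- `AcyclicAddEdge`
  | aTest (key1 key2 : K) (v1 v2 : VRef) (e1 e2 : ERef)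
  | aNew (key1 key2 : K) (v1 v2 : VRef) (e1 e2 : ERef)
  | aLink (c : AddCtx K) (e1 e2 : ERef)
  | aInsert (c : AddCtx K) (e1 e2 : ERef)
  | aAdded (c : AddCtx K)
  | aMark (c : AddCtx K) (ne1 ne2 : ERef)
  -- `AcyclicRemoveEdge`
  | rTest (key2 : K) (e1 e2 : ERef)
  | rMark (e1 e2 : ERef)
  -- Physical removal of the locked node `e2`, with locked predecessor `e1`; then return `flag`.
  | uRead (flag : Bool) (e1 e2 : ERef)
  | uWrite (flag : Bool) (e1 e2 : ERef) (w : Option ERef)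
  -- `AcyclicContainsEdge`
  | cStart (key2 : K) (v1 : VRef)
  | cTest (key2 : K) (e : ERef)
  | cNext (key2 : K) (e : ERef)
  | cCheckVal (key2 : K) (e : ERef)
  | cCheckStatus (e : ERef)
  -- `PathExists`: the scan of the edge list of the vertex with the key `kx`, and the outer loop.
  | pStart (p : PathCtx K) (kx : Val K) (v : VRef)
  | pTest (p : PathCtx K) (kx : Val K) (e : ERef)
  | pStatus (p : PathCtx K) (kx : Val K) (e : ERef)
  | pVal (p : PathCtx K) (kx : Val K) (e : ERef)
  | pNext (p : PathCtx K) (kx : Val K) (e : ERef)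
  | pCheck (p : PathCtx K) (kx : Val K)
  | pLoop (p : PathCtx K)

/-- Start of `HelpSearchEdge(key1, key2)`: the smaller key is searched first. -/
def PC.helpSearch {K : Type*} [LinearOrder K] (m : EMethod) (key1 key2 : K) : PC K :=
  .vTest (.helpFst m key1 key2) (toVal (min key1 key2)) vertexHead

/-- Continuation of an edge method after `HelpSearchEdge` has returned `v1` and `v2`. -/
def PC.afterHelp {K : Type*} (m : EMethod) (key1 key2 : K) (v1 v2 : VRef) : PC K :=
  match m with
  | .add => .mark1 (.add key1 key2 v1 v2) v1 v2
  | .rem => .mark1 (.rem key1 key2 v1 v2) v1 v2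
  | .con => .cStart key2 v1

/-- Call of `PathExists(key2, key1)`. -/
def PC.callPath {K : Type*} (c : AddCtx K) : PC K :=
  .vTest (.pathSrc c) (toVal c.key2) vertexHead

/-- Continuation of `AcyclicAddEdge` after `PathExists` has returned `cycle_flag`. -/
def PC.afterPath {K : Type*} (c : AddCtx K) (cycleFlag : Bool) : PC K :=
  match cycleFlag with
  | true => .lStart (.new c)
  | false => .aAdded c

/-- Continuation of a search in the vertex list that found the unmarked vertex node `v`.  The
second search of `HelpSearchEdge` starts at the vertex node returned by the first one. -/
def VCont.found {K : Type*} [LinearOrder K] (κ : VCont K) (v : VRef) : PC K :=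
  match κ with
  | .contains => .ret true
  | .helpFst m key1 key2 => .vTest (.helpSnd m key1 key2 v) (toVal (max key1 key2)) v
  | .helpSnd m key1 key2 u =>
      if key1 < key2 then PC.afterHelp m key1 key2 u v else PC.afterHelp m key1 key2 v u
  | .pathSrc c => .pStart { ctx := c, localR := ∅, explored := ∅ } (toVal c.key2) v
  | .pathKey p kx => .pStart p kx v

/-- Continuation of a search in the vertex list that found no unmarked vertex node. -/
def VCont.notFound {K : Type*} (κ : VCont K) : PC K :=
  match κ with
  | .contains => .ret false
  | .helpFst _ _ _ => .ret false
  | .helpSnd _ _ _ _ => .ret false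
  | .pathSrc c => PC.afterPath c false
  | .pathKey p kx => .pLoop { p with explored := insert kx p.explored }

/-- Continuation after the adjacent edge nodes `e1`, `e2` have been locked and validated. -/
def LCont.located {K : Type*} (κ : LCont K) (e1 e2 : ERef) : PC K :=
  match κ with
  | .add key1 key2 v1 v2 => .aTest key1 key2 v1 v2 e1 e2
  | .rem _ key2 _ _ => .rTest key2 e1 e2
  | .new c => .aMark c e1 e2

/-- Continuation after the locks on two edge nodes have been released. -/
def ERel.next {K : Type*} (ρ : ERel K) : PC K :=
  match ρ with
  | .retry κ => .lStart κ
  | .path c => PC.callPath c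
  | .ret flag => .ret flag

/-- Continuation after the locks on two vertex nodes have been released. -/
def VRel.next {K : Type*} (ρ : VRel K) : PC K :=
  match ρ with
  | .retry m key => .vlStart m key
  | .ret flag => .ret flag

/-! ## Steps of a thread -/

/-- `Step σ t h p h' p'`: the thread `t` can pass in one atomic step from the control state `p` to
`p'`, changing the heap from `h` to `h'`. -/
inductive Step {K T : Type*} [LinearOrder K] (σ : EStatus) (t : T) :
    Heap K T → PC K → Heap K T → PC K → Prop
  -- Invocations and responses.
  | callAddVertex {h} (key : K) : Step σ t h .idle h (.vlStart .add key)
  | callRemoveVertex {h} (key : K) : Step σ t h .idle h (.vlStart .rem key)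
  | callContainsVertex {h} (key : K) :
      Step σ t h .idle h (.vTest .contains (toVal key) vertexHead)
  | callAddEdge {h} (key1 key2 : K) : Step σ t h .idle h (PC.helpSearch .add key1 key2)
  | callRemoveEdge {h} (key1 key2 : K) : Step σ t h .idle h (PC.helpSearch .rem key1 key2)
  | callContainsEdge {h} (key1 key2 : K) : Step σ t h .idle h (PC.helpSearch .con key1 key2)
  | response {h flag} : Step σ t h (.ret flag) h .idle
  -- while (read(v.val) < key) { v := read(v.vnext) }
  | vTest_lt {h κ key v n} : h.vnode v = some n → n.val < key →
      Step σ t h (.vTest κ key v) h (.vNext κ key v)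
  | vTest_ge {h κ key v n} : h.vnode v = some n → ¬ n.val < key →
      Step σ t h (.vTest κ key v) h (.vCheckVal κ key v)
  | vNext {h κ key v n w} : h.vnode v = some n → n.vnext = some w →
      Step σ t h (.vNext κ key v) h (.vTest κ key w)
  -- if (read(v.val) ≠ key ∨ read(v.marked))
  | vCheckVal_ne {h κ key v n} : h.vnode v = some n → n.val ≠ key →
      Step σ t h (.vCheckVal κ key v) h κ.notFound
  | vCheckVal_eq {h κ key v n} : h.vnode v = some n → n.val = key →
      Step σ t h (.vCheckVal κ key v) h (.vCheckMark κ v)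
  | vCheckMark_true {h κ v n} : h.vnode v = some n → n.marked = true →
      Step σ t h (.vCheckMark κ v) h κ.notFound
  | vCheckMark_false {h κ v n} : h.vnode v = some n → n.marked = false →
      Step σ t h (.vCheckMark κ v) h (κ.found v)
  -- `LocateVertex`: v1 := VertexHead; v2 := read(v1.vnext); search with predecessor
  | vlStart {h m key n w} : h.vnode vertexHead = some n → n.vnext = some w →
      Step σ t h (.vlStart m key) h (.vlTest m key vertexHead w)
  | vlTest_lt {h m key v1 v2 n} : h.vnode v2 = some n → n.val < toVal key →
      Step σ t h (.vlTest m key v1 v2) h (.vlNext m key v1 v2)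
  | vlTest_ge {h m key v1 v2 n} : h.vnode v2 = some n → ¬ n.val < toVal key →
      Step σ t h (.vlTest m key v1 v2) h (.vlAcq1 m key v1 v2)
  | vlNext {h m key v1 v2 n w} : h.vnode v2 = some n → n.vnext = some w →
      Step σ t h (.vlNext m key v1 v2) h (.vlTest m key v2 w)
  | vlAcq1 {h m key v1 v2 n} : h.vnode v1 = some n → n.lock = none →
      Step σ t h (.vlAcq1 m key v1 v2) (h.setV v1 { n with lock := some t }) (.vlAcq2 m key v1 v2)
  | vlAcq2 {h m key v1 v2 n} : h.vnode v2 = some n → n.lock = none →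
      Step σ t h (.vlAcq2 m key v1 v2) (h.setV v2 { n with lock := some t }) (.vlVal1 m key v1 v2)
  -- `ValidateVertex`: ¬ v1.marked ∧ ¬ v2.marked ∧ v1.vnext = v2
  | vlVal1_ok {h m key v1 v2 n} : h.vnode v1 = some n → n.marked = false →
      Step σ t h (.vlVal1 m key v1 v2) h (.vlVal2 m key v1 v2)
  | vlVal1_fail {h m key v1 v2 n} : h.vnode v1 = some n → n.marked = true →
      Step σ t h (.vlVal1 m key v1 v2) h (.vRel1 (.retry m key) v1 v2)
  | vlVal2_ok {h m key v1 v2 n} : h.vnode v2 = some n → n.marked = false →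
      Step σ t h (.vlVal2 m key v1 v2) h (.vlVal3 m key v1 v2)
  | vlVal2_fail {h m key v1 v2 n} : h.vnode v2 = some n → n.marked = true →
      Step σ t h (.vlVal2 m key v1 v2) h (.vRel1 (.retry m key) v1 v2)
  | vlVal3_ok {h m key v1 v2 n} : h.vnode v1 = some n → n.vnext = some v2 →
      Step σ t h (.vlVal3 m key v1 v2) h (.vlDone m key v1 v2)
  | vlVal3_fail {h m key v1 v2 n} : h.vnode v1 = some n → n.vnext ≠ some v2 →
      Step σ t h (.vlVal3 m key v1 v2) h (.vRel1 (.retry m key) v1 v2)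
  -- `AddVertex`: if (read(v2.val) ≠ key) insert a new vertex node between v1 and v2
  | vaTest_ne {h key v1 v2 n} : h.vnode v2 = some n → n.val ≠ toVal key →
      Step σ t h (.vlDone .add key v1 v2) h (.vaNew key v1 v2)
  | vaTest_eq {h key v1 v2 n} : h.vnode v2 = some n → n.val = toVal key →
      Step σ t h (.vlDone .add key v1 v2) h (.vRel1 (.ret false) v1 v2)
  | vaNew {h key v1 v2 v3 eh et} :
      h.vnode v3 = none → h.enode eh = none → h.enode et = none → eh ≠ et →
      Step σ t h (.vaNew key v1 v2) (h.newV σ v3 eh et (toVal key)) (.vaLink v1 v2 v3)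
  | vaLink {h v1 v2 v3 n} : h.vnode v3 = some n →
      Step σ t h (.vaLink v1 v2 v3) (h.setV v3 { n with vnext := some v2 }) (.vaInsert v1 v2 v3)
  | vaInsert {h v1 v2 v3 n} : h.vnode v1 = some n →
      Step σ t h (.vaInsert v1 v2 v3) (h.setV v1 { n with vnext := some v3 })
        (.vRel1 (.ret true) v1 v2)
  -- `RemoveVertex`: if (read(v2.val) = key) mark v2; write(v1.vnext, v2.vnext)
  | vrTest_eq {h key v1 v2 n} : h.vnode v2 = some n → n.val = toVal key →
      Step σ t h (.vlDone .rem key v1 v2) h (.vrMark v1 v2)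
  | vrTest_ne {h key v1 v2 n} : h.vnode v2 = some n → n.val ≠ toVal key →
      Step σ t h (.vlDone .rem key v1 v2) h (.vRel1 (.ret false) v1 v2)
  | vrMark {h v1 v2 n} : h.vnode v2 = some n →
      Step σ t h (.vrMark v1 v2) (h.setV v2 { n with marked := true }) (.vrRead v1 v2)
  | vrRead {h v1 v2 n} : h.vnode v2 = some n →
      Step σ t h (.vrRead v1 v2) h (.vrUnlink v1 v2 n.vnext)
  | vrUnlink {h v1 v2 w n} : h.vnode v1 = some n →
      Step σ t h (.vrUnlink v1 v2 w) (h.setV v1 { n with vnext := w }) (.vRel1 (.ret true) v1 v2)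
  | vRel1 {h ρ v1 v2 n} : h.vnode v1 = some n →
      Step σ t h (.vRel1 ρ v1 v2) (h.setV v1 { n with lock := none }) (.vRel2 ρ v2)
  | vRel2 {h ρ v2 n} : h.vnode v2 = some n →
      Step σ t h (.vRel2 ρ v2) (h.setV v2 { n with lock := none }) ρ.next
  -- `AcyclicLocateEdge`: if (read(v1.marked) ∨ read(v2.marked)) return false
  | mark1_true {h κ v1 v2 n} : h.vnode v1 = some n → n.marked = true →
      Step σ t h (.mark1 κ v1 v2) h (.ret false)
  | mark1_false {h κ v1 v2 n} : h.vnode v1 = some n → n.marked = false →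
      Step σ t h (.mark1 κ v1 v2) h (.mark2 κ v2)
  | mark2_true {h κ v2 n} : h.vnode v2 = some n → n.marked = true →
      Step σ t h (.mark2 κ v2) h (.ret false)
  | mark2_false {h κ v2 n} : h.vnode v2 = some n → n.marked = false →
      Step σ t h (.mark2 κ v2) h (.lStart κ)
  -- e1 := read(v1.enext); e2 := read(e1.enext); search with predecessor; lock both
  | lStart {h κ n} : h.vnode κ.src = some n →
      Step σ t h (.lStart κ) h (.lFirst κ n.edgeHead)
  | lFirst {h κ e1 n w} : h.enode e1 = some n → n.enext = some w →
      Step σ t h (.lFirst κ e1) h (.lTest κ e1 w)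
  | lTest_lt {h κ e1 e2 n} : h.enode e2 = some n → n.val < toVal κ.key →
      Step σ t h (.lTest κ e1 e2) h (.lNext κ e1 e2)
  | lTest_ge {h κ e1 e2 n} : h.enode e2 = some n → ¬ n.val < toVal κ.key →
      Step σ t h (.lTest κ e1 e2) h (.lAcq1 κ e1 e2)
  | lNext {h κ e1 e2 n w} : h.enode e2 = some n → n.enext = some w →
      Step σ t h (.lNext κ e1 e2) h (.lTest κ e2 w)
  | lAcq1 {h κ e1 e2 n} : h.enode e1 = some n → n.lock = none →
      Step σ t h (.lAcq1 κ e1 e2) (h.setE e1 { n with lock := some t }) (.lAcq2 κ e1 e2)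
  | lAcq2 {h κ e1 e2 n} : h.enode e2 = some n → n.lock = none →
      Step σ t h (.lAcq2 κ e1 e2) (h.setE e2 { n with lock := some t }) (.lVal1 κ e1 e2)
  -- `ModifiedValidateEdge` or `AcyclicValidateEdge`
  | lVal1_ok {h κ e1 e2 n} : h.enode e1 = some n → κ.Valid n.status →
      Step σ t h (.lVal1 κ e1 e2) h (.lVal2 κ e1 e2)
  | lVal1_fail {h κ e1 e2 n} : h.enode e1 = some n → ¬ κ.Valid n.status →
      Step σ t h (.lVal1 κ e1 e2) h (.eRel1 (.retry κ) e1 e2)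
  | lVal2_ok {h κ e1 e2 n} : h.enode e2 = some n → κ.Valid n.status →
      Step σ t h (.lVal2 κ e1 e2) h (.lVal3 κ e1 e2)
  | lVal2_fail {h κ e1 e2 n} : h.enode e2 = some n → ¬ κ.Valid n.status →
      Step σ t h (.lVal2 κ e1 e2) h (.eRel1 (.retry κ) e1 e2)
  | lVal3_ok {h κ e1 e2 n} : h.enode e1 = some n → n.enext = some e2 →
      Step σ t h (.lVal3 κ e1 e2) h (κ.located e1 e2)
  | lVal3_fail {h κ e1 e2 n} : h.enode e1 = some n → n.enext ≠ some e2 →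
      Step σ t h (.lVal3 κ e1 e2) h (.eRel1 (.retry κ) e1 e2)
  | eRel1 {h ρ e1 e2 n} : h.enode e1 = some n →
      Step σ t h (.eRel1 ρ e1 e2) (h.setE e1 { n with lock := none }) (.eRel2 ρ e2)
  | eRel2 {h ρ e2 n} : h.enode e2 = some n →
      Step σ t h (.eRel2 ρ e2) (h.setE e2 { n with lock := none }) ρ.next
  -- `AcyclicAddEdge`: if (read(e2.val) ≠ key2) insert a new edge node e3 between e1 and e2,
  -- release the locks and call `PathExists(key2, key1)`
  | aTest_eq {h key1 key2 v1 v2 e1 e2 n} : h.enode e2 = some n → n.val = toVal key2 →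
      Step σ t h (.aTest key1 key2 v1 v2 e1 e2) h (.eRel1 (.ret true) e1 e2)
  | aTest_ne {h key1 key2 v1 v2 e1 e2 n} : h.enode e2 = some n → n.val ≠ toVal key2 →
      Step σ t h (.aTest key1 key2 v1 v2 e1 e2) h (.aNew key1 key2 v1 v2 e1 e2)
  | aNew {h key1 key2 v1 v2 e1 e2 e3} : h.enode e3 = none →
      Step σ t h (.aNew key1 key2 v1 v2 e1 e2) (h.newE e3 (toVal key2))
        (.aLink ⟨key1, key2, v1, v2, e3⟩ e1 e2)
  | aLink {h c e1 e2 n} : h.enode c.e3 = some n →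
      Step σ t h (.aLink c e1 e2) (h.setE c.e3 { n with enext := some e2 }) (.aInsert c e1 e2)
  | aInsert {h c e1 e2 n} : h.enode e1 = some n →
      Step σ t h (.aInsert c e1 e2) (h.setE e1 { n with enext := some c.e3 })
        (.eRel1 (.path c) e1 e2)
  -- no cycle detected: write(e3.status, added)
  | aAdded {h c n} : h.enode c.e3 = some n →
      Step σ t h (.aAdded c) (h.setE c.e3 { n with status := .added }) (.ret true)
  -- cycle detected, after `NewLocateEdge`: write(e3.status, marked); write(ne1.enext, ne2.enext)
  | aMark {h c ne1 ne2 n} : h.enode c.e3 = some n →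
      Step σ t h (.aMark c ne1 ne2) (h.setE c.e3 { n with status := .marked })
        (.uRead false ne1 ne2)
  -- `AcyclicRemoveEdge`: if (read(e2.val) = key2) mark e2; write(e1.enext, e2.enext)
  | rTest_eq {h key2 e1 e2 n} : h.enode e2 = some n → n.val = toVal key2 →
      Step σ t h (.rTest key2 e1 e2) h (.rMark e1 e2)
  | rTest_ne {h key2 e1 e2 n} : h.enode e2 = some n → n.val ≠ toVal key2 →
      Step σ t h (.rTest key2 e1 e2) h (.eRel1 (.ret true) e1 e2)
  | rMark {h e1 e2 n} : h.enode e2 = some n →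
      Step σ t h (.rMark e1 e2) (h.setE e2 { n with status := .marked }) (.uRead true e1 e2)
  -- write(e1.enext, e2.enext); release the locks
  | uRead {h flag e1 e2 n} : h.enode e2 = some n →
      Step σ t h (.uRead flag e1 e2) h (.uWrite flag e1 e2 n.enext)
  | uWrite {h flag e1 e2 w n} : h.enode e1 = some n →
      Step σ t h (.uWrite flag e1 e2 w) (h.setE e1 { n with enext := w })
        (.eRel1 (.ret flag) e1 e2)
  -- `AcyclicContainsEdge`
  | cStart {h key2 v1 n} : h.vnode v1 = some n →
      Step σ t h (.cStart key2 v1) h (.cTest key2 n.edgeHead)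
  | cTest_lt {h key2 e n} : h.enode e = some n → n.val < toVal key2 →
      Step σ t h (.cTest key2 e) h (.cNext key2 e)
  | cTest_ge {h key2 e n} : h.enode e = some n → ¬ n.val < toVal key2 →
      Step σ t h (.cTest key2 e) h (.cCheckVal key2 e)
  | cNext {h key2 e n w} : h.enode e = some n → n.enext = some w →
      Step σ t h (.cNext key2 e) h (.cTest key2 w)
  | cCheckVal_ne {h key2 e n} : h.enode e = some n → n.val ≠ toVal key2 →
      Step σ t h (.cCheckVal key2 e) h (.ret false)
  | cCheckVal_eq {h key2 e n} : h.enode e = some n → n.val = toVal key2 →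
      Step σ t h (.cCheckVal key2 e) h (.cCheckStatus e)
  | cCheckStatus_ne {h e n} : h.enode e = some n → n.status ≠ .added →
      Step σ t h (.cCheckStatus e) h (.ret false)
  | cCheckStatus_eq {h e n} : h.enode e = some n → n.status = .added →
      Step σ t h (.cCheckStatus e) h (.ret true)
  -- `PathExists`: e := read(v.enext);
  -- while (read(e.enext) ≠ null) { if (e is not marked) add read(e.val) to local_R;
  --   e := read(e.enext) }
  | pStart {h p kx v n} : h.vnode v = some n →
      Step σ t h (.pStart p kx v) h (.pTest p kx n.edgeHead)
  | pTest_null {h p kx e n} : h.enode e = some n → n.enext = none →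
      Step σ t h (.pTest p kx e) h (.pCheck p kx)
  | pTest_some {h p kx e n} : h.enode e = some n → n.enext ≠ none →
      Step σ t h (.pTest p kx e) h (.pStatus p kx e)
  | pStatus_marked {h p kx e n} : h.enode e = some n → n.status = .marked →
      Step σ t h (.pStatus p kx e) h (.pNext p kx e)
  | pStatus_ne {h p kx e n} : h.enode e = some n → n.status ≠ .marked →
      Step σ t h (.pStatus p kx e) h (.pVal p kx e)
  | pVal {h p kx e n} : h.enode e = some n →
      Step σ t h (.pVal p kx e) h (.pNext { p with localR := insert n.val p.localR } kx e)
  | pNext {h p kx e n w} : h.enode e = some n → n.enext = some w →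
      Step σ t h (.pNext p kx e) h (.pTest p kx w)
  -- if (key1 ∈ local_R) return true; otherwise kx.explored := true
  | pCheck_mem {h p kx} : toVal p.ctx.key1 ∈ p.localR →
      Step σ t h (.pCheck p kx) h (PC.afterPath p.ctx true)
  | pCheck_notMem {h p kx} : toVal p.ctx.key1 ∉ p.localR →
      Step σ t h (.pCheck p kx) h (.pLoop { p with explored := insert kx p.explored })
  -- while (some kx in local_R is not explored) { search for kx }; return false
  | pLoop_some {h p kx} : kx ∈ p.localR → kx ∉ p.explored →
      Step σ t h (.pLoop p) h (.vTest (.pathKey p kx) kx vertexHead)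
  | pLoop_none {h p} : p.localR ⊆ p.explored →
      Step σ t h (.pLoop p) h (PC.afterPath p.ctx false)

/-! ## Global states and executions -/

/-- A global state: the shared heap and the control state of every thread. -/
structure State (K T : Type*) where
  heap : Heap K T
  pc : T → PC K

/-- The initial state: the graph is empty and no method has been invoked. -/
def State.init (K T : Type*) (σ : EStatus) : State K T where
  heap := initHeap K T σ
  pc := fun _ => .idle

/-- One event of an execution: some thread performs one atomic step. -/
def State.Next {K T : Type*} [LinearOrder K] [DecidableEq T] (σ : EStatus) (S S' : State K T) :
    Prop :=
  ∃ (t : T) (p' : PC K),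
    Step σ t S.heap (S.pc t) S'.heap p' ∧ S'.pc = Function.update S.pc t p'

/-- `S` is a global state of some concurrent execution. -/
def State.Reachable {K T : Type*} [LinearOrder K] [DecidableEq T] (σ : EStatus) (S : State K T) :
    Prop :=
  Relation.ReflTransGen (State.Next σ) (State.init K T σ) S

/-! ## The abstract graph -/

namespace Heap

variable {K T : Type*}

/-- `v.vnext = w`. -/
def VNextRel (h : Heap K T) (v w : VRef) : Prop :=
  ∃ n, h.vnode v = some n ∧ n.vnext = some w

/-- `e.enext = f`. -/
def ENextRel (h : Heap K T) (e f : ERef) : Prop :=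
  ∃ n, h.enode e = some n ∧ n.enext = some f

/-- The vertex node `n` with the key `k` represents the vertex `k` of the abstract graph: it is
reachable from `VertexHead` and not marked. -/
def IsVertexNode (h : Heap K T) (k : K) (n : VNode K T) : Prop :=
  ∃ v, Relation.ReflTransGen h.VNextRel vertexHead v ∧ h.vnode v = some n ∧
    n.val = toVal k ∧ n.marked = false

/-- The vertices of the abstract graph. -/
def absV (h : Heap K T) : Set K := {k | ∃ n, h.IsVertexNode k n}

/-- `(k, l)` is an edge of the abstract graph with status `added`: both ends are vertices of the
abstract graph, and the edge list of the vertex node of `k` contains an edge node with key `l` and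
status `added`. -/
def AddedEdge (h : Heap K T) (k l : K) : Prop :=
  l ∈ h.absV ∧ ∃ n, h.IsVertexNode k n ∧ ∃ e m, Relation.ReflTransGen h.ENextRel n.edgeHead e ∧
    h.enode e = some m ∧ m.val = toVal l ∧ m.status = .added

end Heap

/-- The edges with status `added` contain no directed cycle (of any length `≥ 1`). -/
def State.AddedAcyclic {K T : Type*} (S : State K T) : Prop :=
  ∀ k : K, ¬ Relation.TransGen S.heap.AddedEdge k k

end AcyclicGraph

/-! The proof stamps every edge node with the value of a ghost clock at the moment when it is linked
into an edge list. Fix a stamp `N` that is not in the future, and consider the unmarked edge nodes,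
in transit or added, with stamp at most `N` that belong to unmarked vertex nodes (`IsEdge h g N`).
This relation on keys can only shrink: marks are never cleared, later insertions get larger stamps,
and a new vertex node, even one that reuses an old key, starts with an empty edge list. So once
there is no path between two keys in this relation, there never will be one
(`Evolves.not_transGen`).

The decisive invariant is `HeapInv.added`: if an edge node `e` for `(k, l)` has status added, then
no path leads from `l` to `k` along the present edges with stamp at most that of `e`. It excludes
cycles. On a cycle of added edges choose one with the largest stamp; the rest of the cycle, or the
edge itself if it is a loop, is a forbidden path (`HeapInv.acyclic`). Edges in transit count in the
relation, so of two concurrent insertions that would close a cycle together, the one stamped later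
has to take the other into account.

The invariant is established when `PathExists` returns false. Its set `R` need not be a snapshot of
any state. It suffices that every present edge with stamp at most that of `e3` that leaves an
explored key has its target in `R`; when all of `R` is explored, `R` contains all keys reachable
from `key2`, and `key1` is not in `R` (`PathCtx.Inv.not_transGen`). Since the relation shrinks,
other threads cannot destroy this closedness. The searches without locks are complete for it,
because a node that is reachable from the current position of a search stays reachable from there as
long as it is unmarked, even if the position itself is unlinked in the meantime (`Evolves.vreach`,
`Evolves.ereach`).

The rest is a rely-guarantee argument. Every control state has an assertion (`PC.Inv`). A step
establishes the assertion of its own thread and preserves the heap invariant (`Step.sound`), and its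
effect as seen by the other threads (`Rely`) leaves their assertions intact (`PC.Inv.stable`). -/

namespace AcyclicGraph

open Relation

/-! ### Paths in relations -/

section Relations

variable {α : Type*} {r r' s : α → α → Prop}

/-- Bypassing the node `b`, which follows `a`, keeps every other node reachable. -/
theorem reflTransGen_bypass {a b : α} (hr : ∀ x y, x ≠ a → r x y → r' x y)
    (ha : ∀ y, r a y → y = b) (hb : ∀ y, r' b y → r' a y) {x z : α}
    (h : ReflTransGen r x z) (hz : z ≠ b) : ReflTransGen r' x z := by
  induction h using ReflTransGen.head_induction_on with
  | refl => exact .refl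
  | @head x y hxy _ ih =>
    by_cases hx : x = a
    · subst hx
      obtain rfl := ha _ hxy
      rcases ih.cases_head with h | ⟨w, hw, h⟩
      · exact absurd h.symm hz
      · exact .head (hb _ hw) h
    · exact .head (hr _ _ hx hxy) ih

theorem reflTransGen_eq_or_of_functional (hr : ∀ x y z, r x y → r x z → y = z) {x y z : α}
    (hxy : ReflTransGen r x y) (hxz : ReflTransGen r x z) :
    ReflTransGen r y z ∨ ReflTransGen r z y :=
  ReflTransGen.total_of_right_unique (fun _ _ _ h h' => hr _ _ _ h h') hxy hxz

/-- Serves to cut a cycle open at one of its newest edges: `r` will be the older edges, `r'` the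
newest ones. -/
theorem transGen_or_exists {a b : α} (h : TransGen s a b) (hs : ∀ x y, s x y → r x y ∨ r' x y) :
    TransGen r a b ∨ ∃ x y, ReflTransGen s a x ∧ r' x y ∧ ReflTransGen s y b := by
  induction h with
  | single h =>
    rcases hs _ _ h with h' | h'
    · exact .inl (.single h')
    · exact .inr ⟨_, _, .refl, h', .refl⟩
  | tail hab hbc ih =>
    rcases ih with ih | ⟨x, y, hx, hxy, hy⟩
    · rcases hs _ _ hbc with h' | h'
      · exact .inl (.tail ih h')
      · exact .inr ⟨_, _, hab.to_reflTransGen, h', .refl⟩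
    · exact .inr ⟨x, y, hx, hxy, hy.tail hbc⟩

end Relations

/-! ### Keys and the infinite values -/

section Val

variable {K : Type*}

theorem toVal_injective : Function.Injective (toVal (K := K)) := fun a b h => by
  simpa [toVal] using h

@[simp] theorem toVal_inj {a b : K} : toVal a = toVal b ↔ a = b := toVal_injective.eq_iff

@[simp] theorem toVal_ne_bot (k : K) : toVal k ≠ ⊥ := by simp [toVal]

@[simp] theorem toVal_ne_top (k : K) : toVal k ≠ ⊤ := by
  intro h
  have : ((k : WithTop K) : WithBot (WithTop K)) = ((⊤ : WithTop K) : WithBot (WithTop K)) := h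
  simp at this

@[simp] theorem bot_ne_toVal (k : K) : ⊥ ≠ toVal k := (toVal_ne_bot k).symm

@[simp] theorem top_ne_toVal (k : K) : ⊤ ≠ toVal k := (toVal_ne_top k).symm

theorem bot_lt_toVal [LinearOrder K] (k : K) : ⊥ < toVal k := WithBot.bot_lt_coe _

end Val

/-! ### Ghost history, heap invariant and rely condition -/

/-- Auxiliary history: `ins e` is the time of the insertion of the edge node `e`, `owner e` the
vertex node to whose edge list `e` belongs, `vins` the set of the vertex nodes that were inserted
into the vertex list, `adder` and `vadder` the thread that created a node. -/
structure Ghost (T : Type*) where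
  clock : ℕ
  ins : ERef → ℕ
  owner : ERef → Option VRef
  adder : ERef → Option T
  vins : VRef → Prop
  vadder : VRef → Option T

section Invariant

variable {K T : Type*}

abbrev Heap.VReach (h : Heap K T) : VRef → VRef → Prop := ReflTransGen h.VNextRel

abbrev Heap.EReach (h : Heap K T) : ERef → ERef → Prop := ReflTransGen h.ENextRel

/-- The edge node `f`, inserted until time `N`, represents the edge `(k, l)` in the edge list of
the unmarked vertex node `v`. -/
def IsEdgeNode (h : Heap K T) (g : Ghost T) (N : ℕ) (v : VRef) (f : ERef) (k l : K) : Prop :=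
  g.owner f = some v ∧ g.ins f ≤ N ∧
    (∃ n, h.vnode v = some n ∧ n.val = toVal k ∧ n.marked = false) ∧
    ∃ m, h.enode f = some m ∧ m.val = toVal l ∧ m.status ≠ .marked

/-- Neither the presence of the target vertex nor reachability of the nodes is required, and edges
in transit count. The larger the relation, the stronger the statement that it contains no path;
`PathExists` can match it because it collects keys whether or not they have a vertex. -/
def IsEdge (h : Heap K T) (g : Ghost T) (N : ℕ) (k l : K) : Prop :=
  ∃ v f, IsEdgeNode h g N v f k l

theorem IsEdgeNode.mono {h : Heap K T} {g : Ghost T} {N N' : ℕ} {v f k l}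
    (he : IsEdgeNode h g N v f k l) (hN : N ≤ N') : IsEdgeNode h g N' v f k l :=
  ⟨he.1, he.2.1.trans hN, he.2.2⟩

theorem IsEdge.mono {h : Heap K T} {g : Ghost T} {N N' : ℕ} {k l}
    (he : IsEdge h g N k l) (hN : N ≤ N') : IsEdge h g N' k l :=
  let ⟨v, f, h⟩ := he; ⟨v, f, h.mono hN⟩

theorem Heap.VNextRel.functional {h : Heap K T} (x y z) (h₁ : h.VNextRel x y)
    (h₂ : h.VNextRel x z) : y = z := by
  obtain ⟨n, hn, hy⟩ := h₁
  obtain ⟨n', hn', hz⟩ := h₂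
  grind

theorem Heap.ENextRel.functional {h : Heap K T} (x y z) (h₁ : h.ENextRel x y)
    (h₂ : h.ENextRel x z) : y = z := by
  obtain ⟨n, hn, hy⟩ := h₁
  obtain ⟨n', hn', hz⟩ := h₂
  grind

variable [LinearOrder K]

/-- The invariant of the vertex list. -/
structure VInv (h : Heap K T) (V : VRef → Prop) : Prop where
  alloc : ∀ {v}, V v → ∃ n, h.vnode v = some n
  head : V vertexHead ∧ ∃ n, h.vnode vertexHead = some n ∧ n.val = ⊥
  next : ∀ {v n w}, V v → h.vnode v = some n → n.vnext = some w →
    V w ∧ ∃ n', h.vnode w = some n' ∧ n.val < n'.val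
  -- A node is marked before it is unlinked, so only marked nodes drop out of the list.
  reach : ∀ {v n}, V v → h.vnode v = some n → n.marked = false → h.VReach vertexHead v

/-- The invariant of the edge lists. -/
structure EInv (h : Heap K T) (O : ERef → Option VRef) : Prop where
  alloc : ∀ {e v}, O e = some v → (∃ m, h.enode e = some m) ∧ ∃ n, h.vnode v = some n
  head : ∀ {v n}, h.vnode v = some n →
    O n.edgeHead = some v ∧ ∃ m, h.enode n.edgeHead = some m ∧ m.val = ⊥
  next : ∀ {e v m f}, O e = some v → h.enode e = some m → m.enext = some f →
    O f = some v ∧ ∃ m', h.enode f = some m' ∧ m.val < m'.val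
  -- A scan that meets a null pointer has therefore reached a sentinel and missed no node with an
  -- application key.
  null : ∀ {e v m}, O e = some v → h.enode e = some m → m.enext = none → m.val = ⊤
  -- The vertex node `v` may be marked here: `AcyclicAddEdge` must find its node again even if the
  -- vertex has been removed.
  reach : ∀ {e v m n}, O e = some v → h.enode e = some m → m.status ≠ .marked →
    h.vnode v = some n → h.EReach n.edgeHead e

/-- The invariant of the heap. -/
structure HeapInv (h : Heap K T) (g : Ghost T) : Prop where
  V : VInv h g.vins
  E : EInv h g.owner
  -- Only sentinels can belong to a vertex node that has been allocated but not yet inserted.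
  vins : ∀ {e v m l}, g.owner e = some v → h.enode e = some m → m.val = toVal l → g.vins v
  clock : ∀ e, g.ins e ≤ g.clock
  -- The bound `g.ins e` includes `e` itself, which excludes loops. Without a bound by a past time
  -- the statement would not be stable, because newer edges in transit may close a cycle until their
  -- threads withdraw them.
  added : ∀ {e v m l n k}, g.owner e = some v → h.enode e = some m → m.status = .added →
    m.val = toVal l → h.vnode v = some n → n.val = toVal k → ¬ TransGen (IsEdge h g (g.ins e)) l k

/-- What every step guarantees. -/
structure Evolves (h : Heap K T) (g : Ghost T) (h' : Heap K T) (g' : Ghost T) : Prop where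
  vnode : ∀ {v n}, h.vnode v = some n → ∃ n', h'.vnode v = some n' ∧ n'.val = n.val ∧
    (n.marked = true → n'.marked = true)
  vins : ∀ {v}, g.vins v → g'.vins v
  enode : ∀ {e m}, h.enode e = some m → ∃ m', h'.enode e = some m' ∧ m'.val = m.val ∧
    (m.status = .marked → m'.status = .marked)
  owner : ∀ {e v}, g.owner e = some v → g'.owner e = some v ∧ g'.ins e = g.ins e
  -- Only the target has to be unmarked. The start may have been unlinked; it keeps its pointer into
  -- the list.
  vreach : ∀ {v w n}, h.VReach v w → h'.vnode w = some n → n.marked = false → h'.VReach v w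
  ereach : ∀ {e f m}, h.EReach e f → h'.enode f = some m → m.status ≠ .marked → h'.EReach e f
  -- Edges up to a past time can disappear but not arise. All facts about paths are transported by
  -- this clause.
  edge : ∀ {N v f k l}, N ≤ g.clock → IsEdgeNode h' g' N v f k l → IsEdgeNode h g N v f k l

/-- What the steps of the other threads guarantee to the thread `u`. -/
structure Rely (u : T) (h : Heap K T) (g : Ghost T) (h' : Heap K T) (g' : Ghost T) : Prop
    extends Evolves h g h' g' where
  vlock : ∀ {v n}, g.vins v → h.vnode v = some n → n.lock = some u → h'.vnode v = some n
  vpriv : ∀ {v n}, ¬ g.vins v → g.vadder v = some u → h.vnode v = some n →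
    ¬ g'.vins v ∧ g'.vadder v = some u ∧ h'.vnode v = some n
  -- In contrast to vertex nodes, a lock does not freeze an edge node completely: `AcyclicAddEdge`
  -- writes the status added without holding the lock.
  elock : ∀ {e v m}, g.owner e = some v → h.enode e = some m → m.lock = some u →
    ∃ m', h'.enode e = some m' ∧ m'.val = m.val ∧ m'.lock = m.lock ∧ m'.enext = m.enext ∧
      (m'.status = m.status ∨ m.status = .transit ∧ m'.status = .added)
  epriv : ∀ {e m}, g.owner e = none → g.adder e = some u → h.enode e = some m →
    g'.owner e = none ∧ g'.adder e = some u ∧ h'.enode e = some m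
  -- Only the creator ends the status transit: a removal demands status added. Hence the final write
  -- of added never revives a marked node.
  etransit : ∀ {e v m}, g.owner e = some v → g.adder e = some u → h.enode e = some m →
    m.status = .transit → g'.adder e = some u ∧
      ∃ m', h'.enode e = some m' ∧ m'.val = m.val ∧ m'.status = .transit

/-- A step of the thread `t` with this effect preserves the heap invariant and does not interfere
with the other threads. -/
structure Sound (t : T) (h : Heap K T) (g : Ghost T) (h' : Heap K T) (g' : Ghost T) : Prop where
  inv : HeapInv h' g'
  evolves : Evolves h g h' g'
  rely : ∀ u, u ≠ t → Rely u h g h' g'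

omit [LinearOrder K] in
theorem Evolves.not_transGen {h h' : Heap K T} {g g' : Ghost T} (H : Evolves h g h' g') {N k l}
    (hN : N ≤ g.clock) (hn : ¬ TransGen (IsEdge h g N) k l) : ¬ TransGen (IsEdge h' g' N) k l :=
  fun ht => hn (TransGen.mono (fun _ _ ⟨v, f, he⟩ => ⟨v, f, H.edge hN he⟩) _ _ ht)

theorem VInv.of_reach {h : Heap K T} {V} (H : VInv h V) {v w} (hr : h.VReach v w) (hv : V v) :
    V w := by
  induction hr with
  | refl => exact hv
  | tail _ h ih => obtain ⟨n, hn, hw⟩ := h; exact (H.next ih hn hw).1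

/-- Keys grow strictly along the list, so a search that has reached a key not below the wanted one
cannot have a different wanted node ahead of it. -/
theorem VInv.eq_or_lt {h : Heap K T} {V} (H : VInv h V) {v w n n'} (hr : h.VReach v w) (hv : V v)
    (hn : h.vnode v = some n) (hn' : h.vnode w = some n') : v = w ∨ n.val < n'.val := by
  induction hr generalizing n' with
  | refl => exact .inl rfl
  | tail hr' h ih =>
    obtain ⟨n₁, hn₁, hw⟩ := h
    obtain ⟨-, n₂, hn₂, hlt⟩ := H.next (H.of_reach hr' hv) hn₁ hw
    right
    obtain rfl : n₂ = n' := by grind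
    rcases ih hn₁ with rfl | h
    · obtain rfl : n = n₁ := by grind
      exact hlt
    · exact h.trans hlt

theorem EInv.of_reach {h : Heap K T} {O} (H : EInv h O) {e f v} (hr : h.EReach e f)
    (he : O e = some v) : O f = some v := by
  induction hr with
  | refl => exact he
  | tail _ h ih => obtain ⟨n, hn, hw⟩ := h; exact (H.next ih hn hw).1

theorem EInv.eq_or_lt {h : Heap K T} {O} (H : EInv h O) {e f v m m'} (hr : h.EReach e f)
    (he : O e = some v) (hm : h.enode e = some m) (hm' : h.enode f = some m') :
    e = f ∨ m.val < m'.val := by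
  induction hr generalizing m' with
  | refl => exact .inl rfl
  | tail hr' h ih =>
    obtain ⟨n₁, hn₁, hw⟩ := h
    obtain ⟨-, n₂, hn₂, hlt⟩ := H.next (H.of_reach hr' he) hn₁ hw
    right
    obtain rfl : n₂ = m' := by grind
    rcases ih hn₁ with rfl | h
    · obtain rfl : m = n₁ := by grind
      exact hlt
    · exact h.trans hlt

end Invariant

/-! ### Effect of single writes and allocations -/

section Updates

variable {K T : Type*}

@[simp] theorem Heap.setE_vnode (h : Heap K T) (e m) : (h.setE e m).vnode = h.vnode := rfl

@[simp] theorem Heap.setV_enode (h : Heap K T) (v n) : (h.setV v n).enode = h.enode := rfl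

theorem Heap.setE_enode (h : Heap K T) (e m f) :
    (h.setE e m).enode f = if f = e then some m else h.enode f := by
  simp [Heap.setE, Function.update_apply]

theorem Heap.setV_vnode (h : Heap K T) (v n w) :
    (h.setV v n).vnode w = if w = v then some n else h.vnode w := by
  simp [Heap.setV, Function.update_apply]

theorem Heap.setV_ereach (h : Heap K T) (v n) : (h.setV v n).EReach = h.EReach := rfl

theorem Heap.setV_vnextRel {h : Heap K T} {v n'} {x y} :
    (h.setV v n').VNextRel x y ↔ if x = v then n'.vnext = some y else h.VNextRel x y := by
  simp only [VNextRel, setV_vnode]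
  split <;> simp

theorem Heap.setE_enextRel {h : Heap K T} {e m'} {x y} :
    (h.setE e m').ENextRel x y ↔ if x = e then m'.enext = some y else h.ENextRel x y := by
  simp only [ENextRel, setE_enode]
  split <;> simp

theorem Heap.exists_setE {h : Heap K T} {e m m' f m₁} (hm : h.enode e = some m)
    (hval : m'.val = m.val) (hf : h.enode f = some m₁) :
    ∃ m₂, (h.setE e m').enode f = some m₂ ∧ m₂.val = m₁.val := by
  rw [setE_enode]
  split <;> grind

theorem Heap.vnextRel_iff {h : Heap K T} {v n y} (hn : h.vnode v = some n) :
    h.VNextRel v y ↔ n.vnext = some y := by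
  simp [VNextRel, hn]

theorem Heap.enextRel_iff {h : Heap K T} {e m y} (hn : h.enode e = some m) :
    h.ENextRel e y ↔ m.enext = some y := by
  simp [ENextRel, hn]

theorem Heap.setV_vreach_of_eq {h : Heap K T} {v n n'} (hn : h.vnode v = some n)
    (hx : n'.vnext = n.vnext) : (h.setV v n').VReach = h.VReach := by
  have : (h.setV v n').VNextRel = h.VNextRel := by
    ext x y
    rw [Heap.setV_vnextRel]
    split
    · subst x; rw [Heap.vnextRel_iff hn, hx]
    · rfl
  rw [Heap.VReach, this]

theorem Heap.setE_ereach_of_eq {h : Heap K T} {e m m'} (hm : h.enode e = some m)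
    (hx : m'.enext = m.enext) : (h.setE e m').EReach = h.EReach := by
  have : (h.setE e m').ENextRel = h.ENextRel := by
    ext x y
    rw [Heap.setE_enextRel]
    split
    · subst x; rw [Heap.enextRel_iff hm, hx]
    · rfl
  rw [Heap.EReach, this]

/-! ### Soundness of the writes to shared memory -/

variable [LinearOrder K]

/-- Writing to a vertex node, with insertion of nodes of the own thread into the vertex list. -/
theorem Sound.setV {t : T} {h : Heap K T} {g : Ghost T} (H : HeapInv h g) {v n n'}
    {V' : VRef → Prop} (hn : h.vnode v = some n) (hval : n'.val = n.val)
    (heh : n'.edgeHead = n.edgeHead) (hmark : n.marked = true → n'.marked = true)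
    (hown : g.vins v ∧ (n.lock = none ∨ n.lock = some t) ∨ ¬ g.vins v ∧ g.vadder v = some t)
    (hV : ∀ w, g.vins w → V' w) (hV' : ∀ w, V' w → g.vins w ∨ g.vadder w = some t)
    (HV : VInv (h.setV v n') V')
    (hreach : ∀ {a w n₁}, h.VReach a w → (h.setV v n').vnode w = some n₁ → n₁.marked = false →
      (h.setV v n').VReach a w) :
    Sound t h g (h.setV v n') { g with vins := V' } := by
  have hE : Evolves h g (h.setV v n') { g with vins := V' } := by
    constructor
    · intro w n₁ h₁
      rw [Heap.setV_vnode]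
      split <;> grind
    · exact fun h => hV _ h
    · intro e m hm; exact ⟨m, hm, rfl, id⟩
    · exact fun h => ⟨h, rfl⟩
    · exact hreach
    · exact fun h _ _ => h
    · rintro N w f k l hN ⟨h₁, h₂, ⟨n₁, hn₁, hk, hm⟩, h₃⟩
      refine ⟨h₁, h₂, ?_, h₃⟩
      rw [Heap.setV_vnode] at hn₁
      split at hn₁
      · subst w
        refine ⟨n, hn, by grind, ?_⟩
        -- Marks are never cleared, so a node unmarked after the write was unmarked before.
        cases hx : n.marked <;> grind
      · exact ⟨n₁, hn₁, hk, hm⟩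
  refine ⟨⟨HV, ?_, ?_, H.clock, ?_⟩, hE, fun u hu => ⟨hE, ?_, ?_, ?_, ?_, ?_⟩⟩
  · constructor
    · intro e w he
      obtain ⟨h₁, n₁, h₂⟩ := H.E.alloc he
      refine ⟨h₁, ?_⟩
      rw [Heap.setV_vnode]
      split <;> grind
    · intro w n₁ h₁
      rw [Heap.setV_vnode] at h₁
      split at h₁
      · cases h₁
        have := H.E.head hn
        grind [Heap.setV_enode]
      · exact H.E.head h₁
    · exact H.E.next
    · exact H.E.null
    · intro e w m n₁ he hm hs hw
      rw [Heap.setV_ereach]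
      rw [Heap.setV_vnode] at hw
      split at hw
      · cases hw
        subst w
        rw [heh]
        exact H.E.reach he hm hs hn
      · exact H.E.reach he hm hs hw
  · exact fun h₁ h₂ h₃ => hV _ (H.vins h₁ h₂ h₃)
  · intro e w m l n₁ k he hm hs hl hw hk
    refine hE.not_transGen (H.clock e) ?_
    rw [Heap.setV_vnode] at hw
    split at hw
    · cases hw
      subst w
      exact H.added he hm hs hl hn (by grind)
    · exact H.added he hm hs hl hw hk
  · intro w n₁ hw h₁ h₂
    rw [Heap.setV_vnode]
    split <;> grind
  · intro w n₁ hw h₁ h₂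
    refine ⟨fun h₃ => ?_, h₁, ?_⟩
    · have := hV' _ h₃
      grind
    · rw [Heap.setV_vnode]
      split <;> grind
  · exact fun _ hm _ => ⟨_, hm, rfl, rfl, rfl, .inl rfl⟩
  · exact fun h₁ h₂ h₃ => ⟨h₁, h₂, h₃⟩
  · exact fun _ h₁ h₂ h₃ => ⟨h₁, _, h₂, rfl, h₃⟩

/-- Writing to an edge node, with insertion of nodes of the own thread into edge lists. -/
theorem Sound.setE {t : T} {h : Heap K T} {g : Ghost T} (H : HeapInv h g) {e m m'}
    {O' : ERef → Option VRef} {I' : ERef → ℕ} {C' : ℕ}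
    (he : h.enode e = some m) (hval : m'.val = m.val)
    (hmark : m.status = .marked → m'.status = .marked)
    (hlock : ∀ v, g.owner e = some v → m.lock = none ∨ m.lock = some t ∨
      m'.lock = m.lock ∧ m'.enext = m.enext ∧ m.status = .transit ∧ m'.status = .added)
    (hpriv : g.owner e = none → g.adder e = some t)
    (htr : m.status = .transit → m'.status = .transit ∨ g.adder e = some t)
    (hO : ∀ x v, g.owner x = some v → O' x = some v ∧ I' x = g.ins x)
    (hO' : ∀ x v, O' x = some v → g.owner x = some v ∨ g.owner x = none ∧ g.adder x = some t ∧
      g.vins v ∧ g.clock < I' x ∧ x ≠ e ∧ ∀ m, h.enode x = some m → m.status ≠ .added)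
    (hI : ∀ x, I' x ≤ C')
    (hadd : m'.status = .added → m.status ≠ .added → ∀ v n k l, g.owner e = some v →
      h.vnode v = some n → n.val = toVal k → m.val = toVal l →
      ¬ TransGen (IsEdge h g (g.ins e)) l k)
    (HE : EInv (h.setE e m') O')
    (hreach : ∀ {a f m₁}, h.EReach a f → (h.setE e m').enode f = some m₁ → m₁.status ≠ .marked →
      (h.setE e m').EReach a f) :
    Sound t h g (h.setE e m') { g with owner := O', ins := I', clock := C' } := by
  have hE : Evolves h g (h.setE e m') { g with owner := O', ins := I', clock := C' } := by
    constructor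
    · exact fun h => ⟨_, h, rfl, id⟩
    · exact fun h => h
    · intro f m₁ h₁
      rw [Heap.setE_enode]
      split <;> grind
    · exact fun h => hO _ _ h
    · exact fun h _ _ => h
    · exact hreach
    · rintro N w f k l hN ⟨h₁, h₂, h₃, ⟨m₁, hm₁, hk, hm⟩⟩
      dsimp only at h₁ h₂
      -- A node inserted by this step has a stamp above the clock, hence above `N`, and is not
      -- counted.
      have h₄ : g.owner f = some w := by
        rcases hO' _ _ h₁ with h | h
        · exact h
        · omega
      refine ⟨h₄, (hO _ _ h₄).2 ▸ h₂, h₃, ?_⟩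
      rw [Heap.setE_enode] at hm₁
      split at hm₁ <;> grind
  refine ⟨⟨⟨H.V.alloc, H.V.head, H.V.next, H.V.reach⟩, HE, ?_, hI, ?_⟩, hE,
    fun u hu => ⟨hE, ?_, ?_, ?_, ?_, ?_⟩⟩
  · intro f v m₁ l h₁ h₂ h₃
    rcases hO' _ _ h₁ with h | h
    · rw [Heap.setE_enode] at h₂
      have := @HeapInv.vins _ _ _ _ _ H
      split at h₂ <;> grind
    · exact h.2.2.1
  · intro f v m₁ l n k h₁ h₂ h₃ h₄ h₅ h₆
    dsimp only at h₁
    rw [Heap.setE_enode] at h₂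
    rcases hO' _ _ h₁ with h | h
    · change ¬ TransGen (IsEdge _ _ (I' f)) l k
      rw [(hO _ _ h).2]
      refine hE.not_transGen (H.clock f) ?_
      split at h₂
      · subst f
        cases h₂
        -- Either the node was added before and its old fact survives, or this write makes it added
        -- and `hadd` supplies the fact.
        by_cases hs : m.status = .added
        · exact H.added h he hs (by grind) h₅ h₆
        · exact hadd h₃ hs _ _ _ _ h h₅ h₆ (by grind)
      · exact H.added h h₂ h₃ h₄ h₅ h₆
    · rw [if_neg h.2.2.2.2.1] at h₂
      exact absurd h₃ (h.2.2.2.2.2 _ h₂)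
  · exact fun _ hm _ => hm
  · exact fun h₁ h₂ h₃ => ⟨h₁, h₂, h₃⟩
  · intro f v m₁ h₁ h₂ h₃
    rw [Heap.setE_enode]
    split
    · subst f
      have := hlock _ h₁
      grind
    · exact ⟨_, h₂, rfl, rfl, rfl, .inl rfl⟩
  · intro f m₁ h₁ h₂ h₃
    dsimp only
    rw [Heap.setE_enode]
    refine ⟨?_, h₂, ?_⟩
    · cases hf : O' f with
      | none => rfl
      | some v => have := hO' _ _ hf; grind
    · split <;> grind
  · intro f v m₁ h₁ h₂ h₃ h₄
    dsimp only
    rw [Heap.setE_enode]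
    split <;> grind

/-- Writing the lock or the mark of a vertex node. -/
theorem Sound.setV_of_vnext_eq {t : T} {h : Heap K T} {g : Ghost T} (H : HeapInv h g) {v n n'}
    (hn : h.vnode v = some n) (hval : n'.val = n.val) (hnext : n'.vnext = n.vnext)
    (heh : n'.edgeHead = n.edgeHead) (hmark : n.marked = true → n'.marked = true)
    (hv : g.vins v) (hlock : n.lock = none ∨ n.lock = some t) :
    Sound t h g (h.setV v n') g := by
  refine Sound.setV (V' := g.vins) H hn hval heh hmark (.inl ⟨hv, hlock⟩) (fun _ => id)
    (fun _ => .inl) ?_ ?_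
  · constructor
    · intro w hw
      have := H.V.alloc hw
      rw [Heap.setV_vnode]; split <;> simp_all
    · refine ⟨H.V.head.1, ?_⟩
      have := H.V.head.2
      rw [Heap.setV_vnode]; split <;> grind
    · intro w n₁ x hw h₁ h₂
      have := @VInv.next _ _ _ _ _ H.V
      simp only [Heap.setV_vnode] at h₁ ⊢
      grind
    · intro w n₁ hw h₁ h₂
      rw [Heap.setV_vreach_of_eq hn hnext]
      have := @VInv.reach _ _ _ _ _ H.V
      simp only [Heap.setV_vnode] at h₁
      have : n.marked = false ∨ w ≠ v := by
        by_contra! hc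
        cases hm : n.marked <;> grind
      grind
  · intro a w n₁ h₁ _ _
    rwa [Heap.setV_vreach_of_eq hn hnext]

/-- Linking a new vertex node to its successor. -/
theorem Sound.setV_link {t : T} {h : Heap K T} {g : Ghost T} (H : HeapInv h g) {v n w}
    (hn : h.vnode v = some n) (hnext : n.vnext = none)
    (hv : ¬ g.vins v) (hadd : g.vadder v = some t) :
    Sound t h g (h.setV v { n with vnext := w }) g := by
  -- The old pointer of `v` is null, so the write destroys no link.
  have hr : ∀ {a x}, h.VReach a x → (h.setV v { n with vnext := w }).VReach a x := by
    intro a x hax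
    refine ReflTransGen.mono (fun y z hyz => ?_) _ _ hax
    rw [Heap.setV_vnextRel]
    split
    · subst y; rw [Heap.vnextRel_iff hn] at hyz; simp_all
    · exact hyz
  refine Sound.setV (V' := g.vins) H hn rfl rfl id (.inr ⟨hv, hadd⟩) (fun _ => id)
    (fun _ => .inl) ?_ (fun h _ _ => hr h)
  constructor
  · intro w hw
    have := H.V.alloc hw
    rw [Heap.setV_vnode]; split <;> simp_all
  · refine ⟨H.V.head.1, ?_⟩
    have := H.V.head
    rw [Heap.setV_vnode]; split <;> grind
  · intro w n₁ x hw h₁ h₂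
    have := @VInv.next _ _ _ _ _ H.V
    simp only [Heap.setV_vnode] at h₁ ⊢
    grind
  · intro x n₁ hx h₁ h₂
    apply hr
    have := @VInv.reach _ _ _ _ _ H.V
    simp only [Heap.setV_vnode] at h₁
    grind

/-- Inserting the new vertex node `x` between `v` and `w`. -/
theorem Sound.setV_insert {t : T} {h : Heap K T} {g : Ghost T} (H : HeapInv h g) {v w x n n₂ n₃}
    (hv : g.vins v) (hn : h.vnode v = some n) (hlock : n.lock = some t) (hmark : n.marked = false)
    (hnext : n.vnext = some w) (hw : h.vnode w = some n₂)
    (hx : h.vnode x = some n₃) (hx' : n₃.vnext = some w) (hvx : n.val < n₃.val)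
    (hxw : n₃.val < n₂.val) (hxv : ¬ g.vins x) (hadd : g.vadder x = some t) :
    Sound t h g (h.setV v { n with vnext := some x })
      { g with vins := fun y => g.vins y ∨ y = x } := by
  have hne : x ≠ v := by grind
  -- The link from `v` to `w` is replaced by the two links through `x`.
  have hr : ∀ {a y}, h.VReach a y → (h.setV v { n with vnext := some x }).VReach a y := by
    intro a y hay
    induction hay with
    | refl => exact .refl
    | @tail b c _ hbc ih =>
      refine ih.trans ?_
      by_cases hb : b = v
      · subst hb
        rw [Heap.vnextRel_iff hn, hnext] at hbc
        cases hbc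
        refine .tail (.single (b := x) ?_) ?_
        · rw [Heap.setV_vnextRel, if_pos rfl]
        · rw [Heap.setV_vnextRel, if_neg hne, Heap.vnextRel_iff hx, hx']
      · refine .single ?_
        rwa [Heap.setV_vnextRel, if_neg hb]
  refine Sound.setV H hn rfl rfl id (.inl ⟨hv, .inr hlock⟩) (fun _ => .inl)
    (fun y hy => by grind) ?_ (fun h _ _ => hr h)
  have hnx := @VInv.next _ _ _ _ _ H.V
  constructor
  · rintro y (hy | rfl)
    · have := H.V.alloc hy
      rw [Heap.setV_vnode]; split <;> simp_all
    · rw [Heap.setV_vnode, if_neg hne]; exact ⟨_, hx⟩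
  · refine ⟨.inl H.V.head.1, ?_⟩
    have := H.V.head.2
    rw [Heap.setV_vnode]; split <;> grind
  · intro y n₁ z hy h₁ h₂
    simp only [Heap.setV_vnode] at h₁ ⊢
    grind
  · rintro y n₁ (hy | rfl) h₁ h₂
    · apply hr
      have := @VInv.reach _ _ _ _ _ H.V
      simp only [Heap.setV_vnode] at h₁
      grind
    -- Here the validation matters: `v` is unmarked, hence in the list, and so is its new successor.
    · refine .tail (hr (H.V.reach hv hn hmark)) ?_
      rw [Heap.setV_vnextRel, if_pos rfl]

/-- Removing the marked successor `w` of the vertex node `v`. -/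
theorem Sound.setV_unlink {t : T} {h : Heap K T} {g : Ghost T} (H : HeapInv h g) {v w n n₂}
    (hv : g.vins v) (hn : h.vnode v = some n) (hlock : n.lock = some t)
    (hnext : n.vnext = some w) (hw : h.vnode w = some n₂) (hmark : n₂.marked = true) :
    Sound t h g (h.setV v { n with vnext := n₂.vnext }) g := by
  have hnx := @VInv.next _ _ _ _ _ H.V
  have hne : w ≠ v := by grind
  -- Paths through `v` bypass `w`, and paths that start at `w` survive because `w` keeps its
  -- pointer; only `w` itself may be lost.
  have hr : ∀ {a y}, h.VReach a y → y ≠ w →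
      (h.setV v { n with vnext := n₂.vnext }).VReach a y := by
    intro a y hay hy
    refine reflTransGen_bypass (a := v) ?_ ?_ ?_ hay hy
    · intro b c hb hbc
      rwa [Heap.setV_vnextRel, if_neg hb]
    · intro y hy
      rw [Heap.vnextRel_iff hn] at hy
      grind
    · intro y hy
      rw [Heap.setV_vnextRel, if_neg hne, Heap.vnextRel_iff hw] at hy
      rwa [Heap.setV_vnextRel, if_pos rfl]
  have hr' : ∀ {y n₁}, (h.setV v { n with vnext := n₂.vnext }).vnode y = some n₁ →
      n₁.marked = false → y ≠ w := by
    intro y n₁ h₁ h₂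
    rw [Heap.setV_vnode] at h₁
    grind
  refine Sound.setV (V' := g.vins) H hn rfl rfl id (.inl ⟨hv, .inr hlock⟩) (fun _ => id)
    (fun _ => .inl) ?_ (fun h h₁ h₂ => hr h (hr' h₁ h₂))
  constructor
  · intro y hy
    have := H.V.alloc hy
    rw [Heap.setV_vnode]; split <;> simp_all
  · refine ⟨H.V.head.1, ?_⟩
    have := H.V.head.2
    rw [Heap.setV_vnode]; split <;> grind
  · intro y n₁ z hy h₁ h₂
    simp only [Heap.setV_vnode] at h₁ ⊢
    split at h₁
    -- The new successor of `v` has a larger key by transitivity through `w`.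
    · have h₃ := hnx hv hn hnext
      have h₄ := hnx h₃.1 hw (by grind : n₂.vnext = some z)
      grind
    · grind
  · intro y n₁ hy h₁ h₂
    refine hr ?_ (hr' h₁ h₂)
    have := @VInv.reach _ _ _ _ _ H.V
    simp only [Heap.setV_vnode] at h₁
    grind

/-- Writing the lock or the status of an edge node. -/
theorem Sound.setE_of_enext_eq {t : T} {h : Heap K T} {g : Ghost T} (H : HeapInv h g) {e v m m'}
    (he : h.enode e = some m) (hval : m'.val = m.val) (hnext : m'.enext = m.enext)
    (hmark : m.status = .marked → m'.status = .marked) (hv : g.owner e = some v)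
    (hlock : m.lock = none ∨ m.lock = some t ∨
      m'.lock = m.lock ∧ m.status = .transit ∧ m'.status = .added)
    (htr : m.status = .transit → m'.status = .transit ∨ g.adder e = some t)
    (hadd : m'.status = .added → m.status ≠ .added → ∀ n k l,
      h.vnode v = some n → n.val = toVal k → m.val = toVal l →
      ¬ TransGen (IsEdge h g (g.ins e)) l k) :
    Sound t h g (h.setE e m') g := by
  refine Sound.setE (O' := g.owner) (I' := g.ins) (C' := g.clock) H he hval hmark
    (fun _ _ => by grind) (by grind) htr (fun _ _ h => ⟨h, rfl⟩) (fun _ _ => .inl) H.clock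
    (by grind) ?_ ?_
  · constructor
    · intro f w hf
      have := H.E.alloc hf
      rw [Heap.setE_enode]; split <;> simp_all
    · intro w n hw
      have := H.E.head hw
      rw [Heap.setE_enode]; split <;> grind
    · intro f w m₁ x hf h₁ h₂
      obtain ⟨m₀, hm₀, hx, hv⟩ : ∃ m₀, h.enode f = some m₀ ∧ m₀.enext = some x ∧
          m₀.val = m₁.val := by
        rw [Heap.setE_enode] at h₁; grind
      obtain ⟨h₃, m₂, h₄, h₅⟩ := H.E.next hf hm₀ hx
      obtain ⟨m₃, h₆, h₇⟩ := Heap.exists_setE he hval h₄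
      exact ⟨h₃, m₃, h₆, by rwa [h₇, ← hv]⟩
    · intro f w m₁ hf h₁ h₂
      have := @EInv.null _ _ _ _ _ H.E
      simp only [Heap.setE_enode] at h₁
      grind
    · intro f w m₁ n hf h₁ h₂ hw
      rw [Heap.setE_ereach_of_eq he hnext]
      have := @EInv.reach _ _ _ _ _ H.E
      simp only [Heap.setE_enode] at h₁
      grind [Heap.setE_vnode]
  · intro a w n₁ h₁ _ _
    rwa [Heap.setE_ereach_of_eq he hnext]

/-- Linking a new edge node to its successor. -/
theorem Sound.setE_link {t : T} {h : Heap K T} {g : Ghost T} (H : HeapInv h g) {e m w}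
    (he : h.enode e = some m) (hnext : m.enext = none)
    (hv : g.owner e = none) (hadd : g.adder e = some t) :
    Sound t h g (h.setE e { m with enext := w }) g := by
  have hr : ∀ {a x}, h.EReach a x → (h.setE e { m with enext := w }).EReach a x := by
    intro a x hax
    refine ReflTransGen.mono (fun y z hyz => ?_) _ _ hax
    rw [Heap.setE_enextRel]
    split
    · subst y; rw [Heap.enextRel_iff he] at hyz; simp_all
    · exact hyz
  refine Sound.setE (O' := g.owner) (I' := g.ins) (C' := g.clock) H he rfl id
    (fun _ _ => by grind) (by grind) .inl (fun _ _ h => ⟨h, rfl⟩) (fun _ _ => .inl) H.clock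
    (by grind) ?_ (fun h _ _ => hr h)
  constructor
  · intro f w hf
    have := H.E.alloc hf
    rw [Heap.setE_enode]; split <;> simp_all
  · intro w n hw
    have := H.E.head hw
    rw [Heap.setE_enode]; split <;> grind
  · intro f w m₁ x hf h₁ h₂
    have := @EInv.next _ _ _ _ _ H.E
    simp only [Heap.setE_enode] at h₁ ⊢
    grind
  · intro f w m₁ hf h₁ h₂
    have := @EInv.null _ _ _ _ _ H.E
    simp only [Heap.setE_enode] at h₁
    grind
  · intro f w m₁ n hf h₁ h₂ hw
    apply hr
    have := @EInv.reach _ _ _ _ _ H.E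
    simp only [Heap.setE_enode] at h₁
    grind [Heap.setE_vnode]

/-- Insertion of the edge node `x` into the edge list of `v`. -/
def Ghost.insertE (g : Ghost T) (x : ERef) (v : VRef) : Ghost T :=
  { g with
    owner := fun y => if y = x then some v else g.owner y
    -- The stamp exceeds every time up to the present clock, so the new node enters none of the
    -- relations about which facts are already known.
    ins := fun y => if y = x then g.clock + 1 else g.ins y
    clock := g.clock + 1 }

/-- Inserting the new edge node `x` between `e` and `f`. -/
theorem Sound.setE_insert {t : T} {h : Heap K T} {g : Ghost T} (H : HeapInv h g)
    {v e f x m m₂ m₃} (hv : g.vins v) (he : g.owner e = some v) (hm : h.enode e = some m)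
    (hlock : m.lock = some t) (hmark : m.status ≠ .marked)
    (hnext : m.enext = some f) (hf : h.enode f = some m₂)
    (hx : h.enode x = some m₃) (hx' : m₃.enext = some f) (hvx : m.val < m₃.val)
    (hxw : m₃.val < m₂.val) (hxs : m₃.status = .transit) (hxv : g.owner x = none)
    (hadd : g.adder x = some t) :
    Sound t h g (h.setE e { m with enext := some x }) (g.insertE x v) := by
  have hne : x ≠ e := by grind
  have hr : ∀ {a y}, h.EReach a y → (h.setE e { m with enext := some x }).EReach a y := by
    intro a y hay
    induction hay with
    | refl => exact .refl
    | @tail b c _ hbc ih =>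
      refine ih.trans ?_
      by_cases hb : b = e
      · subst hb
        rw [Heap.enextRel_iff hm, hnext] at hbc
        cases hbc
        refine .tail (.single (b := x) ?_) ?_
        · rw [Heap.setE_enextRel, if_pos rfl]
        · rw [Heap.setE_enextRel, if_neg hne, Heap.enextRel_iff hx, hx']
      · refine .single ?_
        rwa [Heap.setE_enextRel, if_neg hb]
  have hf' := (H.E.next he hm hnext).1
  have hex := @Heap.exists_setE _ _ h e m { m with enext := some x }
  refine Sound.setE H hm rfl id (by grind) (by grind) .inl (fun y _ h => ?_) (fun y _ h => ?_)
    (fun y => ?_) (fun h₁ h₂ => absurd h₁ h₂) ?_ (fun h _ _ => hr h)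
  · grind
  · by_cases hy : y = x
    · subst hy; simp_all
    · simp_all
  · have := H.clock y
    split <;> omega
  constructor
  · intro y w hy
    split at hy
    · subst y
      cases hy
      obtain ⟨m₄, h₄, -⟩ := hex hm rfl hx
      exact ⟨⟨m₄, h₄⟩, (H.E.alloc he).2⟩
    · obtain ⟨⟨m₁, h₁⟩, h₂⟩ := H.E.alloc hy
      obtain ⟨m₄, h₄, -⟩ := hex hm rfl h₁
      exact ⟨⟨m₄, h₄⟩, h₂⟩
  · intro w n hw
    obtain ⟨h₁, m₁, h₂, h₃⟩ := H.E.head hw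
    obtain ⟨m₄, h₄, h₅⟩ := hex hm rfl h₂
    exact ⟨by grind, m₄, h₄, h₅.trans h₃⟩
  · intro y w m₁ z hy h₁ h₂
    suffices (if z = x then some v else g.owner z) = some w ∧
        ∃ m₄, h.enode z = some m₄ ∧ m₁.val < m₄.val by
      obtain ⟨h₃, m₄, h₄, h₅⟩ := this
      obtain ⟨m₅, h₆, h₇⟩ := hex hm rfl h₄
      exact ⟨h₃, m₅, h₆, h₇ ▸ h₅⟩
    rw [Heap.setE_enode] at h₁
    split at h₁
    · grind
    · by_cases hy' : y = x
      · grind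
      · have h₅ := H.E.next (by simpa [hy'] using hy) h₁ h₂
        grind
  · intro y w m₁ hf h₁ h₂
    rw [Heap.setE_enode] at h₁
    by_cases hy' : y = x
    · grind
    · have h₅ := @EInv.null _ _ _ _ _ H.E y w m₁ (by simpa [hy'] using hf)
      grind
  · intro y w m₁ n hy h₁ h₂ hw
    rw [Heap.setE_vnode] at hw
    have hre := @EInv.reach _ _ _ _ _ H.E
    by_cases hyx : y = x
    · subst hyx
      obtain rfl : v = w := by grind
      -- The predecessor `e` is unmarked, hence in the list of `v`, and leads to the new node.
      refine .tail (hr (hre he hm hmark hw)) ?_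
      rw [Heap.setE_enextRel, if_pos rfl]
    · apply hr
      simp only [Heap.setE_enode] at h₁
      grind

/-- Removing the marked successor `f` of the edge node `e`. -/
theorem Sound.setE_unlink {t : T} {h : Heap K T} {g : Ghost T} (H : HeapInv h g) {v e f m m₂}
    (he : g.owner e = some v) (hm : h.enode e = some m) (hlock : m.lock = some t)
    (hnext : m.enext = some f) (hf : h.enode f = some m₂) (hmark : m₂.status = .marked)
    (htop : m₂.val ≠ ⊤) :
    Sound t h g (h.setE e { m with enext := m₂.enext }) g := by
  have h₃ := H.E.next he hm hnext
  have hne : f ≠ e := by grind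
  have hr : ∀ {a y}, h.EReach a y → y ≠ f →
      (h.setE e { m with enext := m₂.enext }).EReach a y := by
    intro a y hay hy
    refine reflTransGen_bypass (a := e) ?_ ?_ ?_ hay hy
    · intro b c hb hbc
      rwa [Heap.setE_enextRel, if_neg hb]
    · intro y hy
      rw [Heap.enextRel_iff hm] at hy
      grind
    · intro y hy
      rw [Heap.setE_enextRel, if_neg hne, Heap.enextRel_iff hf] at hy
      rwa [Heap.setE_enextRel, if_pos rfl]
  have hr' : ∀ {y m₁}, (h.setE e { m with enext := m₂.enext }).enode y = some m₁ →
      m₁.status ≠ .marked → y ≠ f := by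
    intro y n₁ h₁ h₂
    rw [Heap.setE_enode] at h₁
    grind
  refine Sound.setE (O' := g.owner) (I' := g.ins) (C' := g.clock) H hm rfl id
    (fun _ _ => by grind) (by grind) .inl (fun _ _ h => ⟨h, rfl⟩) (fun _ _ => .inl) H.clock
    (by grind) ?_ (fun h h₁ h₂ => hr h (hr' h₁ h₂))
  constructor
  · intro f w hf
    have := H.E.alloc hf
    rw [Heap.setE_enode]; split <;> simp_all
  · intro w n hw
    have := H.E.head hw
    rw [Heap.setE_enode]; split <;> grind
  · intro y w m₁ z hy h₁ h₂
    suffices g.owner z = some w ∧ ∃ m₄, h.enode z = some m₄ ∧ m₁.val < m₄.val by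
      obtain ⟨h₃, m₄, h₄, h₅⟩ := this
      obtain ⟨m₅, h₆, h₇⟩ := Heap.exists_setE hm (m' := { m with enext := m₂.enext }) rfl h₄
      exact ⟨h₃, m₅, h₆, h₇ ▸ h₅⟩
    rw [Heap.setE_enode] at h₁
    split at h₁
    · have h₄ := H.E.next h₃.1 hf (by grind : m₂.enext = some z)
      grind
    · exact H.E.next hy h₁ h₂
  · intro y w m₁ hy h₁ h₂
    -- Since the key of `f` is not `⊤`, the pointer copied from `f` is not null, and `e` does not
    -- become the end of the list.
    have h₄ := H.E.null h₃.1 hf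
    have h₅ := @EInv.null _ _ _ _ _ H.E y w
    rw [Heap.setE_enode] at h₁
    grind
  · intro y w m₁ n hy h₁ h₂ hw
    refine hr ?_ (hr' h₁ h₂)
    have := @EInv.reach _ _ _ _ _ H.E
    simp only [Heap.setE_enode] at h₁
    grind [Heap.setE_vnode]

/-- Allocation of an edge node. -/
theorem Sound.newE {t : T} {h : Heap K T} {g : Ghost T} (H : HeapInv h g) {e key}
    (he : h.enode e = none) :
    Sound t h g (h.newE e key)
      { g with adder := fun f => if f = e then some t else g.adder f } := by
  have hal := @EInv.alloc _ _ _ _ _ H.E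
  have ho : g.owner e = none := by
    cases ho : g.owner e with
    | none => rfl
    | some v => have := hal ho; simp_all
  have hr : ∀ {a x}, h.EReach a x → (h.newE e key).EReach a x := by
    intro a x hax
    refine ReflTransGen.mono (fun y z hyz => ?_) _ _ hax
    rw [Heap.newE, Heap.setE_enextRel, if_neg]
    · exact hyz
    · rintro rfl
      obtain ⟨n, hn, -⟩ := hyz
      simp_all
  have hV : (h.newE e key).vnode = h.vnode := rfl
  have hN : ∀ f, (h.newE e key).enode f = if f = e then
      some { val := key, enext := none, status := .transit, lock := none } else h.enode f :=
    fun f => Heap.setE_enode ..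
  have hE : Evolves h g (h.newE e key)
      { g with adder := fun f => if f = e then some t else g.adder f } := by
    refine ⟨fun h => ⟨_, h, rfl, id⟩, id, ?_, fun h => ⟨h, rfl⟩, fun h _ _ => h,
      fun h _ _ => hr h, ?_⟩
    · intro f m hf
      rw [hN]; split <;> grind
    · rintro N w f k l - ⟨h₁, h₂, h₃, ⟨m₁, hm₁, hk, hm⟩⟩
      refine ⟨h₁, h₂, h₃, m₁, ?_, hk, hm⟩
      dsimp only at h₁
      rw [hN] at hm₁
      grind
  refine ⟨⟨⟨H.V.alloc, H.V.head, H.V.next, H.V.reach⟩, ⟨?_, ?_, ?_, ?_, ?_⟩, ?_, H.clock, ?_⟩,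
    hE, fun u hu => ⟨hE, ?_, ?_, ?_, ?_, ?_⟩⟩
  · intro f v hf
    have := hal hf
    rw [hN, hV]; split <;> simp_all
  · intro v n hn
    have := H.E.head hn
    rw [hN]; split <;> grind
  · intro f v m x hf h₁ h₂
    have := @EInv.next _ _ _ _ _ H.E
    simp only [hN] at h₁ ⊢
    grind
  · intro f v m hf h₁ h₂
    have := @EInv.null _ _ _ _ _ H.E
    simp only [hN] at h₁
    grind
  · intro f v m n hf h₁ h₂ hw
    apply hr
    have := @EInv.reach _ _ _ _ _ H.E
    simp only [hN] at h₁
    grind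
  · intro f v m l hf h₁ h₂
    have := @HeapInv.vins _ _ _ _ _ H
    simp only [hN] at h₁
    grind
  · intro f v m l n k h₁ h₂ h₃ h₄ h₅ h₆
    refine hE.not_transGen (H.clock f) ?_
    rw [hN, if_neg (by grind)] at h₂
    exact H.added h₁ h₂ h₃ h₄ h₅ h₆
  · exact fun _ hm _ => hm
  · exact fun h₁ h₂ h₃ => ⟨h₁, h₂, h₃⟩
  · intro f v m h₁ h₂ h₃
    rw [hN, if_neg (by grind)]
    exact ⟨_, h₂, rfl, rfl, rfl, .inl rfl⟩
  · intro f m h₁ h₂ h₃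
    dsimp only
    rw [hN]
    grind
  · intro f v m h₁ h₂ h₃ h₄
    dsimp only
    rw [hN]
    grind

/-- Allocation of the vertex node `v` with the sentinels `eh` and `et` by the thread `t`. -/
def Ghost.newV (g : Ghost T) (t : T) (v : VRef) (eh et : ERef) : Ghost T :=
  { g with
    -- The sentinels belong to `v` even before `v` is inserted. This creates no edges, since their
    -- keys are infinite.
    owner := fun f => if f = eh ∨ f = et then some v else g.owner f
    vadder := fun w => if w = v then some t else g.vadder w }

omit [LinearOrder K] in
theorem Heap.newV_enode {σ : EStatus} {h : Heap K T} {v eh et key} (f : ERef) :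
    (h.newV σ v eh et key).enode f =
      if f = eh then some { val := ⊥, enext := some et, status := σ, lock := none }
      else if f = et then some { val := ⊤, enext := none, status := σ, lock := none }
      else h.enode f := by
  simp [Heap.newV, Heap.setE, Heap.setV, Function.update_apply]

omit [LinearOrder K] in
theorem Heap.newV_vnode {σ : EStatus} {h : Heap K T} {v eh et key} (w : VRef) :
    (h.newV σ v eh et key).vnode w =
      if w = v then some { val := key, vnext := none, edgeHead := eh, edgeTail := et,
                           marked := false, lock := none }
      else h.vnode w := by
  simp [Heap.newV, Heap.setE, Heap.setV, Function.update_apply]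

/-- Allocation of a vertex node. -/
theorem Sound.newV {σ : EStatus} {t : T} {h : Heap K T} {g : Ghost T} (H : HeapInv h g)
    {v eh et key} (hv : h.vnode v = none) (heh : h.enode eh = none) (het : h.enode et = none)
    (hne : eh ≠ et) : Sound t h g (h.newV σ v eh et key) (g.newV t v eh et) := by
  have hal := @EInv.alloc _ _ _ _ _ H.E
  have hval := @VInv.alloc _ _ _ _ _ H.V
  have ho : ∀ {e}, h.enode e = none → g.owner e = none := by
    intro e he
    cases ho : g.owner e with
    | none => rfl
    | some v => have := hal ho; simp_all
  have hv' : ¬ g.vins v := fun h => by have := hval h; simp_all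
  have hO : ∀ f, (g.newV t v eh et).owner f = if f = eh ∨ f = et then some v else g.owner f :=
    fun _ => rfl
  have hN := Heap.newV_enode (σ := σ) (h := h) (v := v) (eh := eh) (et := et) (key := key)
  have hM := Heap.newV_vnode (σ := σ) (h := h) (v := v) (eh := eh) (et := et) (key := key)
  have hvr : ∀ {a x}, h.VReach a x → (h.newV σ v eh et key).VReach a x := by
    intro a x hax
    refine ReflTransGen.mono (fun y z hyz => ?_) _ _ hax
    obtain ⟨n, hn, hz⟩ := hyz
    exact ⟨n, by grind, hz⟩
  have her : ∀ {a x}, h.EReach a x → (h.newV σ v eh et key).EReach a x := by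
    intro a x hax
    refine ReflTransGen.mono (fun y z hyz => ?_) _ _ hax
    obtain ⟨n, hn, hz⟩ := hyz
    exact ⟨n, by grind, hz⟩
  have hE : Evolves h g (h.newV σ v eh et key) (g.newV t v eh et) := by
    refine ⟨?_, id, ?_, ?_, fun h _ _ => hvr h, fun h _ _ => her h, ?_⟩
    · intro w n hn
      exact ⟨n, by grind, rfl, id⟩
    · intro f m hf
      exact ⟨m, by grind, rfl, id⟩
    · intro f w hf
      refine ⟨?_, rfl⟩
      have := hal hf
      grind
    · rintro N w f k l - ⟨h₁, h₂, ⟨n, hn, hk, hm⟩, ⟨m₁, hm₁, hl, hm'⟩⟩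
      have hb := bot_ne_toVal l
      have ht := top_ne_toVal l
      have h₃ : g.owner f = some w ∧ h.enode f = some m₁ := by
        rw [hO] at h₁
        rw [hN] at hm₁
        grind
      have := hal h₃.1
      exact ⟨h₃.1, h₂, ⟨n, by grind, hk, hm⟩, m₁, h₃.2, hl, hm'⟩
  -- The only new edge nodes are sentinels, so every node with an application key is an old one.
  have hold : ∀ {f w m l}, (g.newV t v eh et).owner f = some w →
      (h.newV σ v eh et key).enode f = some m → m.val = toVal l →
      g.owner f = some w ∧ h.enode f = some m := by
    intro f w m l h₁ h₂ h₃
    have hb := bot_ne_toVal l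
    have ht := top_ne_toVal l
    rw [hO] at h₁
    rw [hN] at h₂
    grind
  refine ⟨⟨⟨?_, ⟨H.V.head.1, ?_⟩, ?_, ?_⟩, ⟨?_, ?_, ?_, ?_, ?_⟩, ?_, H.clock, ?_⟩,
    hE, fun u hu => ⟨hE, ?_, ?_, ?_, ?_, ?_⟩⟩
  · intro w hw
    have := hval hw
    grind
  · have := H.V.head.2
    grind
  · intro w n x (hw : g.vins w) h₁ h₂
    have := @VInv.next _ _ _ _ _ H.V
    change g.vins x ∧ _
    grind
  · intro w n (hw : g.vins w) h₁ h₂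
    apply hvr
    have := @VInv.reach _ _ _ _ _ H.V
    grind
  · intro f w hf
    rw [hO] at hf
    grind
  · intro w n hn
    have := @EInv.head _ _ _ _ _ H.E
    rw [hO]
    grind
  · intro f w m x hf h₁ h₂
    have : (⊥ : Val K) < ⊤ := bot_lt_top
    rw [hO] at hf ⊢
    rw [hN] at h₁
    by_cases hf' : f = eh ∨ f = et
    · simp only [hN]; grind
    · have h₃ := H.E.next (by simpa [hf'] using hf) (by grind : h.enode f = some m) h₂
      grind
  · intro f w m hf h₁ h₂
    have := @EInv.null _ _ _ _ _ H.E
    rw [hO] at hf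
    simp only [hN] at h₁
    grind
  · intro f w m n hf h₁ h₂ hw
    rw [hO] at hf
    rw [hM] at hw
    by_cases hf' : f = eh ∨ f = et
    · rw [if_pos hf'] at hf
      cases hf
      rw [if_pos rfl] at hw
      cases hw
      rcases hf' with rfl | rfl
      · exact .refl
      · refine .single ⟨_, (hN _).trans (if_pos rfl), rfl⟩
    · apply her
      have := @EInv.reach _ _ _ _ _ H.E
      have := @EInv.alloc _ _ _ _ _ H.E
      simp only [hN] at h₁
      grind
  · intro f w m l hf h₁ h₂
    have := hold hf h₁ h₂
    exact H.vins this.1 this.2 h₂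
  · intro f w m l n k h₁ h₂ h₃ h₄ h₅ h₆
    refine hE.not_transGen (H.clock f) ?_
    have := hold h₁ h₂ h₄
    refine H.added this.1 this.2 h₃ h₄ ?_ h₆
    have := hal this.1
    grind
  · intro w n hw h₁ h₂
    grind
  · intro w n hw h₁ h₂
    refine ⟨hw, ?_, by grind⟩
    change (if _ then _ else _) = _
    grind
  · intro f w m h₁ h₂ h₃
    exact ⟨m, by grind, rfl, rfl, rfl, .inl rfl⟩
  · intro f m h₁ h₂ h₃
    exact ⟨by grind, h₂, by grind⟩
  · intro f w m h₁ h₂ h₃ h₄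
    exact ⟨h₂, m, by grind, rfl, h₄⟩

end Updates
-- Assertions of a thread at its control states
section ControlStates

variable {K T : Type*}

/-- The vertex node `v` was inserted and satisfies `P`. -/
def VHas (h : Heap K T) (g : Ghost T) (v : VRef) (P : VNode K T → Prop) : Prop :=
  g.vins v ∧ ∃ n, h.vnode v = some n ∧ P n

/-- The edge node `e` belongs to the edge list of `v` and satisfies `P`. -/
def EHas (h : Heap K T) (g : Ghost T) (v : VRef) (e : ERef) (P : ENode K T → Prop) : Prop :=
  g.owner e = some v ∧ ∃ m, h.enode e = some m ∧ P m

/-- The thread `t` has inserted the edge node `c.e3` with status transit. -/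
def AddCtx.Inv (h : Heap K T) (g : Ghost T) (t : T) (c : AddCtx K) : Prop :=
  VHas h g c.v1 (fun n => n.val = toVal c.key1) ∧
  EHas h g c.v1 c.e3 (fun m => m.val = toVal c.key2 ∧ m.status = .transit) ∧
  g.adder c.e3 = some t

/-- The local sets of `PathExists` respect the edges that are not newer than `c.e3`. -/
def PathCtx.Closed (h : Heap K T) (g : Ghost T) (p : PathCtx K) : Prop :=
  ∀ k l v f, toVal k ∈ p.explored → IsEdgeNode h g (g.ins p.ctx.e3) v f k l → toVal l ∈ p.localR

/-- The invariant of the outer loop of `PathExists`. -/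
def PathCtx.Inv (h : Heap K T) (g : Ghost T) (t : T) (p : PathCtx K) : Prop :=
  p.ctx.Inv h g t ∧ toVal p.ctx.key1 ∉ p.localR ∧ toVal p.ctx.key2 ∈ p.explored ∧ p.Closed h g

/-- The invariant of the scan of the edge list of the vertex with the key `kx`; `P f` holds for
the edge nodes `f` that are still to be visited. -/
def PathCtx.Scan (h : Heap K T) (g : Ghost T) (t : T) (p : PathCtx K) (kx : Val K)
    (P : VRef → ERef → Prop) : Prop :=
  p.ctx.Inv h g t ∧ toVal p.ctx.key2 ∈ insert kx p.explored ∧ p.Closed h g ∧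
  ∀ k l v f, toVal k = kx → IsEdgeNode h g (g.ins p.ctx.e3) v f k l → toVal l ∈ p.localR ∨ P v f

/-- The context of a search by `PathExists`. -/
def VCont.ctx? : VCont K → Option (AddCtx K)
  | .pathSrc c => some c
  | .pathKey p _ => some p.ctx
  | _ => none

/-- A search in the vertex list by `PathExists`: `P v` holds for every vertex node `v` that has to
be found. -/
def VCont.Finds (h : Heap K T) (g : Ghost T) (κ : VCont K) (key : Val K) (P : VRef → Prop) : Prop :=
  -- The claim concerns only vertex nodes that carry a sufficiently old edge. For all vertex nodes
  -- with the given key it would not be stable: another thread may insert one behind the position of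
  -- the search.
  ∀ c, κ.ctx? = some c → ∀ k l v f, toVal k = key → IsEdgeNode h g (g.ins c.e3) v f k l → P v

variable [LinearOrder K]

def VCont.Inv (h : Heap K T) (g : Ghost T) (t : T) (key : Val K) : VCont K → Prop
  | .contains => True
  | .helpFst _ key1 key2 => key = toVal (min key1 key2)
  | .helpSnd _ key1 key2 u =>
      key = toVal (max key1 key2) ∧ VHas h g u (fun n => n.val = toVal (min key1 key2))
  | .pathSrc c => key = toVal c.key2 ∧ c.Inv h g t
  | .pathKey p kx => key = kx ∧ p.Inv h g t

/-- An insertion has to know that `v1` carries `key1`, because the invariant about added edges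
speaks of the keys at both ends; a removal needs no such knowledge. -/
def LCont.Inv (h : Heap K T) (g : Ghost T) (t : T) : LCont K → Prop
  | .add key1 _ v1 _ => VHas h g v1 (fun n => n.val = toVal key1)
  | .rem _ _ _ _ => True
  | .new c => c.Inv h g t

def ERel.Inv (h : Heap K T) (g : Ghost T) (t : T) : ERel K → Prop
  | .retry κ => κ.Inv h g t
  | .path c => c.Inv h g t
  | .ret _ => True

/-- What the thread `t` knows in a control state. -/
def PC.Inv (h : Heap K T) (g : Ghost T) (t : T) : PC K → Prop
  | .idle => True
  | .ret _ => True
  | .vTest κ key v => κ.Inv h g t key ∧ g.vins v ∧ κ.Finds h g key (h.VReach v)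
  | .vNext κ key v => κ.Inv h g t key ∧ VHas h g v (fun n => n.val < key) ∧
      κ.Finds h g key (h.VReach v)
  | .vCheckVal κ key v => κ.Inv h g t key ∧ VHas h g v (fun n => ¬ n.val < key) ∧
      κ.Finds h g key (h.VReach v)
  -- The control state no longer holds the key. By sortedness, `v` is now the only candidate.
  | .vCheckMark κ v => ∃ key, κ.Inv h g t key ∧ VHas h g v (fun n => n.val = key) ∧
      κ.Finds h g key (· = v)
  | .vlStart _ _ => True
  | .vlTest _ key v1 v2 => VHas h g v1 (fun n => n.val < toVal key) ∧ g.vins v2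
  | .vlNext _ key _ v2 => VHas h g v2 (fun n => n.val < toVal key)
  | .vlAcq1 _ key v1 v2 => VHas h g v1 (fun n => n.val < toVal key) ∧
      VHas h g v2 (fun n => ¬ n.val < toVal key)
  | .vlAcq2 _ key v1 v2 => VHas h g v1 (fun n => n.val < toVal key ∧ n.lock = some t) ∧
      VHas h g v2 (fun n => ¬ n.val < toVal key)
  | .vlVal1 _ key v1 v2 => VHas h g v1 (fun n => n.val < toVal key ∧ n.lock = some t) ∧
      VHas h g v2 (fun n => ¬ n.val < toVal key ∧ n.lock = some t)
  | .vlVal2 _ key v1 v2 =>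
      VHas h g v1 (fun n => n.val < toVal key ∧ n.lock = some t ∧ n.marked = false) ∧
      VHas h g v2 (fun n => ¬ n.val < toVal key ∧ n.lock = some t)
  | .vlVal3 _ key v1 v2 =>
      VHas h g v1 (fun n => n.val < toVal key ∧ n.lock = some t ∧ n.marked = false) ∧
      VHas h g v2 (fun n => ¬ n.val < toVal key ∧ n.lock = some t)
  | .vlDone _ key v1 v2 =>
      VHas h g v1 (fun n => n.val < toVal key ∧ n.lock = some t ∧ n.marked = false ∧
        n.vnext = some v2) ∧
      VHas h g v2 (fun n => ¬ n.val < toVal key ∧ n.lock = some t)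
  | .vaNew key v1 v2 =>
      VHas h g v1 (fun n => n.val < toVal key ∧ n.lock = some t ∧ n.marked = false ∧
        n.vnext = some v2) ∧
      VHas h g v2 (fun n => toVal key < n.val ∧ n.lock = some t)
  | .vaLink v1 v2 v3 => ∃ k : Val K,
      VHas h g v1 (fun n => n.val < k ∧ n.lock = some t ∧ n.marked = false ∧
        n.vnext = some v2) ∧
      VHas h g v2 (fun n => k < n.val ∧ n.lock = some t) ∧
      ¬ g.vins v3 ∧ g.vadder v3 = some t ∧
      ∃ n, h.vnode v3 = some n ∧ n.val = k ∧ n.vnext = none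
  | .vaInsert v1 v2 v3 => ∃ k : Val K,
      VHas h g v1 (fun n => n.val < k ∧ n.lock = some t ∧ n.marked = false ∧
        n.vnext = some v2) ∧
      VHas h g v2 (fun n => k < n.val ∧ n.lock = some t) ∧
      ¬ g.vins v3 ∧ g.vadder v3 = some t ∧
      ∃ n, h.vnode v3 = some n ∧ n.val = k ∧ n.vnext = some v2
  | .vrMark v1 v2 => v1 ≠ v2 ∧ VHas h g v1 (fun n => n.lock = some t ∧ n.vnext = some v2) ∧
      VHas h g v2 (fun n => n.lock = some t)
  | .vrRead v1 v2 => v1 ≠ v2 ∧ VHas h g v1 (fun n => n.lock = some t ∧ n.vnext = some v2) ∧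
      VHas h g v2 (fun n => n.lock = some t ∧ n.marked = true)
  | .vrUnlink v1 v2 w => v1 ≠ v2 ∧ VHas h g v1 (fun n => n.lock = some t ∧ n.vnext = some v2) ∧
      VHas h g v2 (fun n => n.lock = some t ∧ n.marked = true ∧ n.vnext = w)
  | .vRel1 _ v1 v2 => v1 ≠ v2 ∧ VHas h g v1 (fun n => n.lock = some t) ∧
      VHas h g v2 (fun n => n.lock = some t)
  | .vRel2 _ v2 => VHas h g v2 (fun n => n.lock = some t)
  | .mark1 κ _ _ => κ.Inv h g t
  | .mark2 κ _ => κ.Inv h g t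
  | .lStart κ => κ.Inv h g t
  | .lFirst κ e1 => κ.Inv h g t ∧ EHas h g κ.src e1 (fun m => m.val < toVal κ.key)
  | .lTest κ e1 e2 => κ.Inv h g t ∧ EHas h g κ.src e1 (fun m => m.val < toVal κ.key) ∧
      g.owner e2 = some κ.src
  | .lNext κ _ e2 => κ.Inv h g t ∧ EHas h g κ.src e2 (fun m => m.val < toVal κ.key)
  | .lAcq1 κ e1 e2 => κ.Inv h g t ∧ EHas h g κ.src e1 (fun m => m.val < toVal κ.key) ∧
      EHas h g κ.src e2 (fun m => ¬ m.val < toVal κ.key)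
  | .lAcq2 κ e1 e2 => κ.Inv h g t ∧
      EHas h g κ.src e1 (fun m => m.val < toVal κ.key ∧ m.lock = some t) ∧
      EHas h g κ.src e2 (fun m => ¬ m.val < toVal κ.key)
  | .lVal1 κ e1 e2 => κ.Inv h g t ∧
      EHas h g κ.src e1 (fun m => m.val < toVal κ.key ∧ m.lock = some t) ∧
      EHas h g κ.src e2 (fun m => ¬ m.val < toVal κ.key ∧ m.lock = some t)
  | .lVal2 κ e1 e2 => κ.Inv h g t ∧
      EHas h g κ.src e1 (fun m => m.val < toVal κ.key ∧ m.lock = some t ∧ κ.Valid m.status) ∧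
      EHas h g κ.src e2 (fun m => ¬ m.val < toVal κ.key ∧ m.lock = some t)
  | .lVal3 κ e1 e2 => κ.Inv h g t ∧
      EHas h g κ.src e1 (fun m => m.val < toVal κ.key ∧ m.lock = some t ∧ κ.Valid m.status) ∧
      EHas h g κ.src e2 (fun m => ¬ m.val < toVal κ.key ∧ m.lock = some t ∧ κ.Valid m.status)
  | .eRel1 ρ e1 e2 => ρ.Inv h g t ∧ e1 ≠ e2 ∧ ∃ v, EHas h g v e1 (fun m => m.lock = some t) ∧
      EHas h g v e2 (fun m => m.lock = some t)
  | .eRel2 ρ e2 => ρ.Inv h g t ∧ ∃ v, EHas h g v e2 (fun m => m.lock = some t)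
  | .aTest key1 key2 v1 _ e1 e2 => VHas h g v1 (fun n => n.val = toVal key1) ∧
      EHas h g v1 e1 (fun m => m.val < toVal key2 ∧ m.lock = some t ∧ m.status ≠ .marked ∧
        m.enext = some e2) ∧
      EHas h g v1 e2 (fun m => ¬ m.val < toVal key2 ∧ m.lock = some t)
  | .aNew key1 key2 v1 _ e1 e2 => VHas h g v1 (fun n => n.val = toVal key1) ∧
      EHas h g v1 e1 (fun m => m.val < toVal key2 ∧ m.lock = some t ∧ m.status ≠ .marked ∧
        m.enext = some e2) ∧
      EHas h g v1 e2 (fun m => toVal key2 < m.val ∧ m.lock = some t)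
  | .aLink c e1 e2 => VHas h g c.v1 (fun n => n.val = toVal c.key1) ∧
      EHas h g c.v1 e1 (fun m => m.val < toVal c.key2 ∧ m.lock = some t ∧ m.status ≠ .marked ∧
        m.enext = some e2) ∧
      EHas h g c.v1 e2 (fun m => toVal c.key2 < m.val ∧ m.lock = some t) ∧
      g.owner c.e3 = none ∧ g.adder c.e3 = some t ∧
      ∃ m, h.enode c.e3 = some m ∧ m.val = toVal c.key2 ∧ m.status = .transit ∧ m.enext = none
  | .aInsert c e1 e2 => VHas h g c.v1 (fun n => n.val = toVal c.key1) ∧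
      EHas h g c.v1 e1 (fun m => m.val < toVal c.key2 ∧ m.lock = some t ∧ m.status ≠ .marked ∧
        m.enext = some e2) ∧
      EHas h g c.v1 e2 (fun m => toVal c.key2 < m.val ∧ m.lock = some t) ∧
      g.owner c.e3 = none ∧ g.adder c.e3 = some t ∧
      ∃ m, h.enode c.e3 = some m ∧ m.val = toVal c.key2 ∧ m.status = .transit ∧ m.enext = some e2
  -- The verdict of `PathExists`; it remains true until the status is written, since old edges only
  -- disappear.
  | .aAdded c => c.Inv h g t ∧ ¬ TransGen (IsEdge h g (g.ins c.e3)) c.key2 c.key1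
  | .aMark c ne1 ne2 => c.Inv h g t ∧ ne2 = c.e3 ∧ ne1 ≠ ne2 ∧
      EHas h g c.v1 ne1 (fun m => m.lock = some t ∧ m.enext = some ne2) ∧
      EHas h g c.v1 ne2 (fun m => m.lock = some t)
  | .rTest _ e1 e2 => e1 ≠ e2 ∧ ∃ v,
      EHas h g v e1 (fun m => m.lock = some t ∧ m.enext = some e2) ∧
      EHas h g v e2 (fun m => m.lock = some t ∧ m.status = .added)
  | .rMark e1 e2 => e1 ≠ e2 ∧ ∃ v,
      EHas h g v e1 (fun m => m.lock = some t ∧ m.enext = some e2) ∧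
      EHas h g v e2 (fun m => m.lock = some t ∧ m.status = .added ∧ m.val ≠ ⊤)
  | .uRead _ e1 e2 => e1 ≠ e2 ∧ ∃ v,
      EHas h g v e1 (fun m => m.lock = some t ∧ m.enext = some e2) ∧
      EHas h g v e2 (fun m => m.lock = some t ∧ m.status = .marked ∧ m.val ≠ ⊤)
  | .uWrite _ e1 e2 w => e1 ≠ e2 ∧ ∃ v,
      EHas h g v e1 (fun m => m.lock = some t ∧ m.enext = some e2) ∧
      EHas h g v e2 (fun m => m.lock = some t ∧ m.status = .marked ∧ m.val ≠ ⊤ ∧ m.enext = w)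
  | .cStart _ _ => True
  | .cTest _ _ => True
  | .cNext _ _ => True
  | .cCheckVal _ _ => True
  | .cCheckStatus _ => True
  | .pStart p kx v => p.Scan h g t kx (fun w _ => w = v)
  | .pTest p kx e => p.Scan h g t kx (fun _ => h.EReach e) ∧ ∃ v, g.owner e = some v
  | .pStatus p kx e => p.Scan h g t kx (fun _ => h.EReach e) ∧ ∃ v, g.owner e = some v
  | .pVal p kx e => p.Scan h g t kx (fun _ => h.EReach e) ∧ ∃ v, g.owner e = some v
  -- The node `e` itself is done: its key is in `localR`, or it was read as marked and so is no
  -- edge.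
  | .pNext p kx e => p.Scan h g t kx (fun _ f => h.EReach e f ∧ f ≠ e) ∧ ∃ v, g.owner e = some v
  | .pCheck p kx => p.Scan h g t kx (fun _ _ => False)
  | .pLoop p => p.Inv h g t

/-! ### Stability of the assertions under steps of other threads -/

variable {h h' : Heap K T} {g g' : Ghost T} {t : T}

omit [LinearOrder K] in
-- Keys are immutable, so facts about them need no lock.
theorem Evolves.vHas (E : Evolves h g h' g') {v} {P : Val K → Prop}
    (H : VHas h g v (fun n => P n.val)) : VHas h' g' v (fun n => P n.val) := by
  obtain ⟨hv, n, hn, hP⟩ := H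
  obtain ⟨n', hn', hval, -⟩ := E.vnode hn
  exact ⟨E.vins hv, n', hn', by simpa only [hval] using hP⟩

omit [LinearOrder K] in
theorem Evolves.eHas (E : Evolves h g h' g') {v e} {P : Val K → Prop}
    (H : EHas h g v e (fun m => P m.val)) : EHas h' g' v e (fun m => P m.val) := by
  obtain ⟨hv, m, hm, hP⟩ := H
  obtain ⟨m', hm', hval, -⟩ := E.enode hm
  exact ⟨(E.owner hv).1, m', hm', by simpa only [hval] using hP⟩

omit [LinearOrder K] in
theorem Rely.vHas (R : Rely t h g h' g') {v} {P : VNode K T → Prop}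
    (hP : ∀ n, P n → n.lock = some t) (H : VHas h g v P) : VHas h' g' v P := by
  obtain ⟨hv, n, hn, hn'⟩ := H
  exact ⟨R.vins hv, n, R.vlock hv hn (hP n hn'), hn'⟩

omit [LinearOrder K] in
theorem Rely.eHas (R : Rely t h g h' g') {v e} {P : ENode K T → Prop}
    (hP : ∀ m, P m → m.lock = some t)
    (hP' : ∀ m m', P m → m'.val = m.val → m'.lock = m.lock → m'.enext = m.enext →
      (m'.status = m.status ∨ m.status = .transit ∧ m'.status = .added) → P m')
    (H : EHas h g v e P) : EHas h' g' v e P := by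
  obtain ⟨hv, m, hm, hPm⟩ := H
  obtain ⟨m', hm', h₁, h₂, h₃, h₄⟩ := R.elock hv hm (hP m hPm)
  exact ⟨(R.owner hv).1, m', hm', hP' m m' hPm h₁ h₂ h₃ h₄⟩

omit [LinearOrder K] in
theorem Rely.addCtx (R : Rely t h g h' g') {c : AddCtx K} (H : c.Inv h g t) : c.Inv h' g' t := by
  obtain ⟨h₁, ⟨h₂, m, h₃, h₄, h₅⟩, h₆⟩ := H
  obtain ⟨h₇, m', h₈, h₉, h₁₀⟩ := R.etransit h₂ h₆ h₃ h₅
  exact ⟨R.toEvolves.vHas (P := (· = toVal c.key1)) h₁,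
    ⟨(R.owner h₂).1, m', h₈, h₉.trans h₄, h₁₀⟩, h₇⟩

omit [LinearOrder K] in
theorem AddCtx.Inv.ins_eq {c : AddCtx K} (H : c.Inv h g t) (E : Evolves h g h' g') :
    g'.ins c.e3 = g.ins c.e3 :=
  (E.owner H.2.1.1).2

/-- The stamp of `c.e3` is fixed and not in the future, so with this bound no edge arises. -/
theorem AddCtx.Inv.edge {c : AddCtx K} (H : c.Inv h g t) (HI : HeapInv h g)
    (E : Evolves h g h' g') {v f k l} (he : IsEdgeNode h' g' (g'.ins c.e3) v f k l) :
    IsEdgeNode h g (g.ins c.e3) v f k l :=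
  E.edge (HI.clock _) (H.ins_eq E ▸ he)

theorem Rely.closed (R : Rely t h g h' g') (HI : HeapInv h g) {p : PathCtx K}
    (H₀ : p.ctx.Inv h g t) (H : p.Closed h g) : p.Closed h' g' :=
  fun k l v f hk he => H k l v f hk (H₀.edge HI R.toEvolves he)

theorem Rely.pathCtx (R : Rely t h g h' g') (HI : HeapInv h g) {p : PathCtx K}
    (H : p.Inv h g t) : p.Inv h' g' t :=
  ⟨R.addCtx H.1, H.2.1, H.2.2.1, R.closed HI H.1 H.2.2.2⟩

/-- The obligation has to be renewed only for edges that survive the step. Their nodes are unmarked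
afterwards, and for such nodes reachability persists. -/
theorem Rely.scan (R : Rely t h g h' g') (HI : HeapInv h g) {p : PathCtx K} {kx}
    {P P' : VRef → ERef → Prop} (H : p.Scan h g t kx P)
    (hP : ∀ v f m, P v f → h'.enode f = some m → m.status ≠ .marked → P' v f) :
    p.Scan h' g' t kx P' :=
  ⟨R.addCtx H.1, H.2.1, R.closed HI H.1 H.2.2.1, fun k l v f hk he =>
    (H.2.2.2 k l v f hk (H.1.edge HI R.toEvolves he)).imp_right fun h₁ => by
      obtain ⟨-, -, -, m, hm, -, hs⟩ := he
      exact hP v f m h₁ hm hs⟩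

theorem Rely.vCont (R : Rely t h g h' g') (HI : HeapInv h g) {κ : VCont K} {key}
    (H : κ.Inv h g t key) : κ.Inv h' g' t key := by
  cases κ with
  | contains => trivial
  | helpFst => exact H
  | helpSnd m key1 key2 u =>
    exact ⟨H.1, R.toEvolves.vHas (P := (· = toVal (min key1 key2))) H.2⟩
  | pathSrc c => exact ⟨H.1, R.addCtx H.2⟩
  | pathKey p kx => exact ⟨H.1, R.pathCtx HI H.2⟩

theorem Rely.finds (R : Rely t h g h' g') (HI : HeapInv h g) {κ : VCont K} {key}
    {P P' : VRef → Prop} (H₀ : κ.Inv h g t key) (H : κ.Finds h g key P)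
    (hP : ∀ v n, P v → h'.vnode v = some n → n.marked = false → P' v) : κ.Finds h' g' key P' := by
  intro c hc k l v f hk he
  have hcI : c.Inv h g t := by
    cases κ <;> simp only [VCont.ctx?, reduceCtorEq, Option.some.injEq] at hc <;> subst hc
    · exact H₀.2
    · exact H₀.2.1
  have h₁ := H c hc k l v f hk (hcI.edge HI R.toEvolves he)
  obtain ⟨-, -, ⟨n, hn, -, hs⟩, -⟩ := he
  exact hP v n h₁ hn hs

theorem Rely.lCont (R : Rely t h g h' g') {κ : LCont K} (H : κ.Inv h g t) : κ.Inv h' g' t := by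
  cases κ with
  | add key1 key2 v1 v2 => exact R.toEvolves.vHas (P := (· = toVal key1)) H
  | rem => trivial
  | new c => exact R.addCtx H

theorem Rely.eRel (R : Rely t h g h' g') {ρ : ERel K} (H : ρ.Inv h g t) : ρ.Inv h' g' t := by
  cases ρ with
  | retry κ => exact R.lCont (κ := κ) H
  | path c => exact R.addCtx (c := c) H
  | ret => trivial

omit [LinearOrder K] in
-- The only change of status possible under a lock held by another thread is to added, and this
-- satisfies both kinds of validation.
theorem LCont.Valid.of_added {κ : LCont K} : κ.Valid .added := by
  cases κ <;> simp [LCont.Valid]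

/-- Freedom from interference. Each conjunct is protected by a lock, by private ownership of a node,
by immutability, or by the shrinking of the old edges. -/
theorem PC.Inv.stable (R : Rely t h g h' g') (HI : HeapInv h g) {p : PC K} (H : p.Inv h g t) :
    p.Inv h' g' t := by
  have E := R.toEvolves
  have hva : ∀ {κ : LCont K} {s s'}, κ.Valid s → s' = s ∨ s = .transit ∧ s' = .added →
      κ.Valid s' := by
    rintro κ s s' h₁ (rfl | ⟨-, rfl⟩)
    · exact h₁
    · exact LCont.Valid.of_added
  cases p with
  | idle | ret | vlStart | cStart | cTest | cNext | cCheckVal | cCheckStatus => trivial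
  | vTest κ key v =>
    exact ⟨R.vCont HI H.1, R.vins H.2.1, R.finds HI H.1 H.2.2 fun _ _ => E.vreach⟩
  | vNext κ key v =>
    exact ⟨R.vCont HI H.1, E.vHas (P := (· < key)) H.2.1, R.finds HI H.1 H.2.2 fun _ _ => E.vreach⟩
  | vCheckVal κ key v =>
    exact ⟨R.vCont HI H.1, E.vHas (P := (¬ · < key)) H.2.1,
      R.finds HI H.1 H.2.2 fun _ _ => E.vreach⟩
  | vCheckMark κ v =>
    obtain ⟨key, H⟩ := H
    exact ⟨key, R.vCont HI H.1, E.vHas (P := (· = key)) H.2.1,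
      R.finds HI H.1 H.2.2 fun _ _ h _ _ => h⟩
  | vlTest m key v1 v2 => exact ⟨E.vHas (P := (· < toVal key)) H.1, R.vins H.2⟩
  | vlNext m key v1 v2 => exact E.vHas (P := (· < toVal key)) H
  | vlAcq1 m key v1 v2 =>
    exact ⟨E.vHas (P := (· < toVal key)) H.1, E.vHas (P := (¬ · < toVal key)) H.2⟩
  | vlAcq2 m key v1 v2 =>
    exact ⟨R.vHas (by grind) H.1, E.vHas (P := (¬ · < toVal key)) H.2⟩
  | vlVal1 | vlVal2 | vlVal3 | vlDone | vaNew =>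
    exact ⟨R.vHas (by grind) H.1, R.vHas (by grind) H.2⟩
  | vaLink | vaInsert =>
    obtain ⟨k, h₁, h₂, h₃, h₄, n, h₅, h₆⟩ := H
    obtain ⟨h₇, h₈, h₉⟩ := R.vpriv h₃ h₄ h₅
    exact ⟨k, R.vHas (by grind) h₁, R.vHas (by grind) h₂, h₇, h₈, n, h₉, h₆⟩
  | vrMark | vrRead | vrUnlink | vRel1 =>
    exact ⟨H.1, R.vHas (by grind) H.2.1, R.vHas (by grind) H.2.2⟩
  | vRel2 => exact R.vHas (by grind) H
  | mark1 κ | mark2 κ | lStart κ => exact R.lCont (κ := κ) H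
  | lFirst κ e1 => exact ⟨R.lCont H.1, E.eHas (P := (· < toVal κ.key)) H.2⟩
  | lNext κ e1 e2 => exact ⟨R.lCont H.1, E.eHas (P := (· < toVal κ.key)) H.2⟩
  | lTest κ e1 e2 =>
    exact ⟨R.lCont H.1, E.eHas (P := (· < toVal κ.key)) H.2.1, (R.owner H.2.2).1⟩
  | lAcq1 κ e1 e2 =>
    exact ⟨R.lCont H.1, E.eHas (P := (· < toVal κ.key)) H.2.1,
      E.eHas (P := (¬ · < toVal κ.key)) H.2.2⟩
  | lAcq2 κ e1 e2 =>
    exact ⟨R.lCont H.1, R.eHas (by grind) (by grind) H.2.1,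
      E.eHas (P := (¬ · < toVal κ.key)) H.2.2⟩
  | lVal1 | lVal2 | lVal3 =>
    exact ⟨R.lCont H.1, R.eHas (by grind) (by grind) H.2.1, R.eHas (by grind) (by grind) H.2.2⟩
  | eRel1 =>
    obtain ⟨h₁, h₂, v, h₃, h₄⟩ := H
    exact ⟨R.eRel h₁, h₂, v, R.eHas (by grind) (by grind) h₃, R.eHas (by grind) (by grind) h₄⟩
  | eRel2 =>
    obtain ⟨h₁, v, h₃⟩ := H
    exact ⟨R.eRel h₁, v, R.eHas (by grind) (by grind) h₃⟩
  | aTest key1 | aNew key1 =>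
    exact ⟨E.vHas (P := (· = toVal key1)) H.1, R.eHas (by grind) (by grind) H.2.1,
      R.eHas (by grind) (by grind) H.2.2⟩
  | aLink c | aInsert c =>
    obtain ⟨h₁, h₂, h₃, h₄, h₅, m, h₆, h₇⟩ := H
    obtain ⟨h₈, h₉, h₁₀⟩ := R.epriv h₄ h₅ h₆
    exact ⟨E.vHas (P := (· = toVal c.key1)) h₁, R.eHas (by grind) (by grind) h₂,
      R.eHas (by grind) (by grind) h₃, h₈, h₉, m, h₁₀, h₇⟩
  | aAdded c =>
    refine ⟨R.addCtx H.1, ?_⟩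
    rw [H.1.ins_eq E]
    exact E.not_transGen (HI.clock _) H.2
  | aMark c =>
    exact ⟨R.addCtx H.1, H.2.1, H.2.2.1, R.eHas (by grind) (by grind) H.2.2.2.1,
      R.eHas (by grind) (by grind) H.2.2.2.2⟩
  | rTest | rMark | uRead | uWrite =>
    obtain ⟨h₁, v, h₂, h₃⟩ := H
    exact ⟨h₁, v, R.eHas (by grind) (by grind) h₂, R.eHas (by grind) (by grind) h₃⟩
  | pStart => exact R.scan HI H fun _ _ _ h _ _ => h
  | pCheck => exact R.scan HI H fun _ _ _ h _ _ => h
  | pTest | pStatus | pVal =>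
    obtain ⟨H, v, hv⟩ := H
    exact ⟨R.scan HI H fun _ _ _ => E.ereach, v, (R.owner hv).1⟩
  | pNext =>
    obtain ⟨H, v, hv⟩ := H
    exact ⟨R.scan HI H fun _ _ _ h h₁ h₂ => ⟨E.ereach h.1 h₁ h₂, h.2⟩, v, (R.owner hv).1⟩
  | pLoop => exact R.pathCtx HI H

end ControlStates

/-! ### Each step establishes its next assertion -/

section Steps

variable {K T : Type*} [LinearOrder K] {h h' : Heap K T} {g g' : Ghost T} {t : T}

theorem Sound.refl (HI : HeapInv h g) : Sound t h g h g := by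
  have E : Evolves h g h g :=
    ⟨fun h => ⟨_, h, rfl, id⟩, id, fun h => ⟨_, h, rfl, id⟩, fun h => ⟨h, rfl⟩,
      fun h _ _ => h, fun h _ _ => h, fun _ h => h⟩
  exact ⟨HI, E, fun u _ => ⟨E, fun _ h _ => h, fun h₁ h₂ h₃ => ⟨h₁, h₂, h₃⟩,
    fun _ h _ => ⟨_, h, rfl, rfl, rfl, .inl rfl⟩, fun h₁ h₂ h₃ => ⟨h₁, h₂, h₃⟩,
    fun _ h₁ h₂ h₃ => ⟨h₁, _, h₂, rfl, h₃⟩⟩⟩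

omit [LinearOrder K] in
theorem VHas.setV {v w n} {P : VNode K T → Prop} (H : VHas h g w P) (hP : w = v → P n) :
    VHas (h.setV v n) g w P := by
  obtain ⟨hw, n', hn', hP'⟩ := H
  refine ⟨hw, ?_⟩
  rw [Heap.setV_vnode]
  split
  · exact ⟨n, rfl, hP ‹_›⟩
  · exact ⟨n', hn', hP'⟩

omit [LinearOrder K] in
theorem VHas.get {v n} {P : VNode K T → Prop} (H : VHas h g v P) (hn : h.vnode v = some n) :
    P n := by
  obtain ⟨-, n', hn', hP⟩ := H
  cases hn.symm.trans hn'
  exact hP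

omit [LinearOrder K] in
theorem VHas.imp {v} {P Q : VNode K T → Prop} (H : VHas h g v P) (hPQ : ∀ n, P n → Q n) :
    VHas h g v Q :=
  ⟨H.1, H.2.imp fun _ h => ⟨h.1, hPQ _ h.2⟩⟩

omit [LinearOrder K] in
theorem VHas.imp_of {v n} {P Q : VNode K T → Prop} (H : VHas h g v P) (hn : h.vnode v = some n)
    (hQ : P n → Q n) : VHas h g v Q :=
  ⟨H.1, n, hn, hQ (H.get hn)⟩

omit [LinearOrder K] in
theorem EHas.setE {v e f m} {P : ENode K T → Prop} (H : EHas h g v f P) (hP : f = e → P m) :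
    EHas (h.setE e m) g v f P := by
  obtain ⟨hw, n', hn', hP'⟩ := H
  refine ⟨hw, ?_⟩
  rw [Heap.setE_enode]
  split
  · exact ⟨m, rfl, hP ‹_›⟩
  · exact ⟨n', hn', hP'⟩

omit [LinearOrder K] in
theorem EHas.get {v e m} {P : ENode K T → Prop} (H : EHas h g v e P) (hm : h.enode e = some m) :
    P m := by
  obtain ⟨-, n', hn', hP⟩ := H
  cases hm.symm.trans hn'
  exact hP

omit [LinearOrder K] in
theorem EHas.imp {v e} {P Q : ENode K T → Prop} (H : EHas h g v e P) (hPQ : ∀ n, P n → Q n) :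
    EHas h g v e Q :=
  ⟨H.1, H.2.imp fun _ h => ⟨h.1, hPQ _ h.2⟩⟩

omit [LinearOrder K] in
theorem EHas.imp_of {v e m} {P Q : ENode K T → Prop} (H : EHas h g v e P)
    (hm : h.enode e = some m) (hQ : P m → Q m) : EHas h g v e Q :=
  ⟨H.1, m, hm, hQ (H.get hm)⟩

omit [LinearOrder K] in
theorem VHas.setV_self {v n} {P : VNode K T → Prop} (hv : g.vins v) (hP : P n) :
    VHas (h.setV v n) g v P :=
  ⟨hv, n, (Heap.setV_vnode ..).trans (if_pos rfl), hP⟩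

omit [LinearOrder K] in
theorem EHas.setE_self {v e m} {P : ENode K T → Prop} (hv : g.owner e = some v) (hP : P m) :
    EHas (h.setE e m) g v e P :=
  ⟨hv, m, (Heap.setE_enode ..).trans (if_pos rfl), hP⟩

omit [LinearOrder K] in
theorem VHas.ne {v w} {P Q : VNode K T → Prop} (H : VHas h g v P) (H' : VHas h g w Q)
    (hPQ : ∀ n, P n → ¬ Q n) : v ≠ w := by
  rintro rfl
  obtain ⟨-, n, hn, hP⟩ := H
  exact hPQ n hP (H'.get hn)

omit [LinearOrder K] in
theorem EHas.ne {v w e f} {P Q : ENode K T → Prop} (H : EHas h g v e P) (H' : EHas h g w f Q)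
    (hPQ : ∀ m, P m → ¬ Q m) : e ≠ f := by
  rintro rfl
  obtain ⟨-, n, hn, hP⟩ := H
  exact hPQ n hP (H'.get hn)

omit [LinearOrder K] in
theorem VHas.newV {σ : EStatus} {v w eh et key} {P : VNode K T → Prop} (H : VHas h g w P)
    (hv : h.vnode v = none) : VHas (h.newV σ v eh et key) (g.newV t v eh et) w P := by
  obtain ⟨hw, n, hn, hP⟩ := H
  refine ⟨hw, n, ?_, hP⟩
  rw [Heap.newV_vnode, if_neg (by grind)]
  exact hn

omit [LinearOrder K] in
theorem EHas.newE {v e f key A} {P : ENode K T → Prop} (H : EHas h g v e P)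
    (hf : h.enode f = none) : EHas (h.newE f key) { g with adder := A } v e P := by
  obtain ⟨hw, m, hm, hP⟩ := H
  refine ⟨hw, m, ?_, hP⟩
  rw [Heap.newE, Heap.setE_enode, if_neg (by grind)]
  exact hm

omit [LinearOrder K] in
theorem EHas.insertE {v w e x} {P : ENode K T → Prop} (H : EHas h g v e P)
    (hx : g.owner x = none) : EHas h (g.insertE x w) v e P := by
  refine ⟨?_, H.2⟩
  have h₁ : e ≠ x := by rintro rfl; exact absurd H.1 (by simp [hx])
  exact (if_neg h₁).trans H.1

omit [LinearOrder K] in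
theorem AddCtx.Inv.setE {c : AddCtx K} (H : c.Inv h g t) {e m m'} (hm : h.enode e = some m)
    (hval : m'.val = m.val) (hst : m'.status = m.status) : c.Inv (h.setE e m') g t := by
  refine ⟨H.1, H.2.1.setE fun he => ?_, H.2.2⟩
  subst he
  rw [hval, hst]
  exact H.2.1.get hm

omit [LinearOrder K] in
theorem LCont.Inv.setE {κ : LCont K} (H : κ.Inv h g t) {e m m'} (hm : h.enode e = some m)
    (hval : m'.val = m.val) (hst : m'.status = m.status) : κ.Inv (h.setE e m') g t := by
  cases κ with
  | add => exact H
  | rem => trivial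
  | new c => exact AddCtx.Inv.setE H hm hval hst

omit [LinearOrder K] in
theorem ERel.Inv.setE {ρ : ERel K} (H : ρ.Inv h g t) {e m m'} (hm : h.enode e = some m)
    (hval : m'.val = m.val) (hst : m'.status = m.status) : ρ.Inv (h.setE e m') g t := by
  cases ρ with
  | retry κ => exact LCont.Inv.setE H hm hval hst
  | path c => exact AddCtx.Inv.setE H hm hval hst
  | ret => trivial

theorem EHas.ne_of_enext (HI : HeapInv h g) {v e f m} (he : g.owner e = some v)
    (hm : h.enode e = some m) (hnext : m.enext = some f) : e ≠ f := by
  obtain ⟨-, m', hm', hlt⟩ := HI.E.next he hm hnext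
  rintro rfl
  cases hm.symm.trans hm'
  exact lt_irrefl _ hlt

theorem VHas.ne_of_vnext (HI : HeapInv h g) {v w n} (hv : g.vins v)
    (hn : h.vnode v = some n) (hnext : n.vnext = some w) : v ≠ w := by
  obtain ⟨-, n', hn', hlt⟩ := HI.V.next hv hn hnext
  rintro rfl
  cases hn.symm.trans hn'
  exact lt_irrefl _ hlt

/-- The search of `NewLocateEdge` finds the edge node that was inserted. -/
theorem AddCtx.Inv.eq_e3 (HI : HeapInv h g) {c : AddCtx K} (H : c.Inv h g t) {e₁ e₂ m₁ m₂}
    (h₁ : g.owner e₁ = some c.v1) (hm₁ : h.enode e₁ = some m₁) (hlt : m₁.val < toVal c.key2)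
    (hs : m₁.status ≠ .marked) (hnext : m₁.enext = some e₂)
    (hm₂ : h.enode e₂ = some m₂) (hge : ¬ m₂.val < toVal c.key2) : e₂ = c.e3 := by
  obtain ⟨⟨-, n, hn, -⟩, ⟨h₃, m₃, hm₃, hval, hst⟩, -⟩ := H
  have hr₁ := HI.E.reach h₁ hm₁ hs hn
  have hr₃ := HI.E.reach h₃ hm₃ (by simp [hst]) hn
  have h₂ := (HI.E.next h₁ hm₁ hnext).1
  -- Both `e₁` and `c.e3` are unmarked, so they lie on one list and are comparable. The key of `e₁`
  -- is smaller, so `c.e3` lies beyond `e₁`; since the key of the successor `e₂` is not below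
  -- `key2`, nothing lies between.
  rcases reflTransGen_eq_or_of_functional Heap.ENextRel.functional hr₁ hr₃ with hr | hr
  · rcases hr.cases_head with rfl | ⟨x, hx, hr⟩
    · grind
    · rw [Heap.enextRel_iff hm₁, hnext] at hx
      cases hx
      rcases HI.E.eq_or_lt hr h₂ hm₂ hm₃ with h | h
      · exact h
      · exact absurd (hval ▸ h) hge
  · rcases HI.E.eq_or_lt hr h₃ hm₃ hm₁ with rfl | h
    · grind
    · exact absurd (h.trans hlt) (hval ▸ lt_irrefl _)

theorem VCont.Inv.found {κ : VCont K} {key v} (H : κ.Inv h g t key)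
    (hv : VHas h g v (fun n => n.val = key)) (hf : κ.Finds h g key (· = v)) :
    (κ.found v).Inv h g t := by
  cases κ with
  | contains => trivial
  | helpFst m key1 key2 =>
    obtain rfl : key = _ := H
    exact ⟨⟨rfl, hv⟩, hv.1, fun c hc => by simp [VCont.ctx?] at hc⟩
  | helpSnd m key1 key2 u =>
    obtain ⟨rfl, hu⟩ := H
    simp only [VCont.found]
    split
    · rename_i hlt
      rw [min_eq_left hlt.le] at hu
      cases m
      · exact hu
      · trivial
      · trivial
    -- This case includes `key1 = key2`, where the second search ends at a node with the same key.
    · rename_i hge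
      rw [max_eq_left (not_lt.1 hge)] at hv
      cases m
      · exact hv
      · trivial
      · trivial
  | pathSrc c =>
    obtain ⟨rfl, hc⟩ := H
    exact ⟨hc, Set.mem_insert _ _, fun _ _ _ _ h => h.elim,
      fun k l w f hk he => .inr (hf c rfl k l w f hk he)⟩
  | pathKey p kx =>
    obtain ⟨rfl, hc, h₁, h₂, h₃⟩ := H
    exact ⟨hc, Set.mem_insert_of_mem _ h₂, h₃,
      fun k l w f hk he => .inr (hf p.ctx rfl k l w f hk he)⟩

omit [LinearOrder K] in
theorem PathCtx.Closed.insert {p : PathCtx K} {kx : Val K} (H : p.Closed h g)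
    (hx : ∀ k l v f, toVal k = kx → IsEdgeNode h g (g.ins p.ctx.e3) v f k l →
      toVal l ∈ p.localR) :
    ({ p with explored := insert kx p.explored } : PathCtx K).Closed h g := by
  rintro k l v f (hk | hk) he
  · exact hx k l v f hk he
  · exact H k l v f hk he

theorem VCont.Inv.notFound {κ : VCont K} {key} (H : κ.Inv h g t key)
    (hf : κ.Finds h g key fun _ => False) : κ.notFound.Inv h g t := by
  cases κ with
  | contains => trivial
  | helpFst => trivial
  | helpSnd => trivial
  | pathSrc c =>
    obtain ⟨rfl, hc⟩ := H
    refine ⟨hc, fun ht => ?_⟩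
    -- A path would need a first edge leaving `key2`, but no vertex node with this key carries one.
    obtain ⟨b, ⟨v, f, he⟩, -⟩ := TransGen.head'_iff.1 ht
    exact hf c rfl _ _ v f rfl he
  | pathKey p kx =>
    obtain ⟨rfl, hc, h₁, h₂, h₃⟩ := H
    exact ⟨hc, h₁, Set.mem_insert_of_mem _ h₂,
      h₃.insert fun k l v f hk he => (hf p.ctx rfl k l v f hk he).elim⟩

omit [LinearOrder K] in
-- Once everything in `localR` is explored, `localR` is closed under the old edges, and it contains
-- all successors of `key2`; by induction it contains every key reachable from `key2`.
theorem PathCtx.Inv.not_transGen {p : PathCtx K} (H : p.Inv h g t)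
    (hsub : p.localR ⊆ p.explored) :
    ¬ TransGen (IsEdge h g (g.ins p.ctx.e3)) p.ctx.key2 p.ctx.key1 := by
  obtain ⟨-, h₁, h₂, h₃⟩ := H
  intro ht
  have key : ∀ l, TransGen (IsEdge h g (g.ins p.ctx.e3)) p.ctx.key2 l → toVal l ∈ p.localR := by
    intro l hl
    induction hl with
    | single he => obtain ⟨v, f, he⟩ := he; exact h₃ _ _ v f h₂ he
    | tail _ he ih => obtain ⟨v, f, he⟩ := he; exact h₃ _ _ v f (hsub ih) he
  exact h₁ (key _ ht)

/-- An unmarked vertex node that carries an edge has been inserted, hence lies in the list, so a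
search from the head has everything ahead of it. -/
theorem VCont.finds_head (HI : HeapInv h g) (κ : VCont K) (key : Val K) :
    κ.Finds h g key (h.VReach vertexHead) := by
  rintro c - k l v f - ⟨ho, -, ⟨n, hn, -, hm⟩, ⟨m, hm', hl, -⟩⟩
  exact HI.V.reach (HI.vins ho hm' hl) hn hm

omit [LinearOrder K] in
theorem VCont.Finds.imp {κ : VCont K} {key : Val K} {P Q : VRef → Prop} (H : κ.Finds h g key P)
    (hPQ : ∀ v n, P v → h.vnode v = some n → n.val = key → n.marked = false → Q v) :
    κ.Finds h g key Q := by
  intro c hc k l v f hk he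
  have h₁ := H c hc k l v f hk he
  obtain ⟨-, -, ⟨n, hn, hv, hm⟩, -⟩ := he
  exact hPQ v n h₁ hn (hv.trans hk) hm

omit [LinearOrder K] in
theorem PathCtx.Scan.imp {p : PathCtx K} {kx} {P Q : VRef → ERef → Prop} (H : p.Scan h g t kx P)
    (hPQ : ∀ v f m n l, P v f → g.owner f = some v → h.enode f = some m → m.val = toVal l →
      m.status ≠ .marked → h.vnode v = some n → Q v f) : p.Scan h g t kx Q := by
  refine ⟨H.1, H.2.1, H.2.2.1, fun k l v f hk he => (H.2.2.2 k l v f hk he).imp_right fun hP => ?_⟩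
  obtain ⟨ho, -, ⟨n, hn, -⟩, m, hm, hl, hs⟩ := he
  exact hPQ v f m n l hP ho hm hl hs hn

theorem LCont.Inv.located (HI : HeapInv h g) {κ : LCont K} {e₁ e₂} (H : κ.Inv h g t)
    (h₁ : EHas h g κ.src e₁ (fun m => m.val < toVal κ.key ∧ m.lock = some t ∧ κ.Valid m.status ∧
      m.enext = some e₂))
    (h₂ : EHas h g κ.src e₂ (fun m => ¬ m.val < toVal κ.key ∧ m.lock = some t ∧
      κ.Valid m.status)) : (κ.located e₁ e₂).Inv h g t := by
  have hne : e₁ ≠ e₂ := by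
    obtain ⟨ho, m, hm, -, -, -, hx⟩ := h₁
    exact EHas.ne_of_enext HI ho hm hx
  cases κ with
  | add key1 key2 v1 v2 => exact ⟨H, h₁, h₂.imp fun _ h => ⟨h.1, h.2.1⟩⟩
  | rem key1 key2 v1 v2 =>
    exact ⟨hne, v1, h₁.imp fun _ h => ⟨h.2.1, h.2.2.2⟩, h₂.imp fun _ h => ⟨h.2.1, h.2.2⟩⟩
  | new c =>
    refine ⟨H, ?_, hne, h₁.imp fun _ h => ⟨h.2.1, h.2.2.2⟩, h₂.imp fun _ h => h.2.1⟩
    obtain ⟨ho, m, hm, hlt, -, hs, hx⟩ := h₁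
    obtain ⟨-, m', hm', hge, -, -⟩ := h₂
    exact AddCtx.Inv.eq_e3 HI H ho hm hlt hs hx hm' hge

/-- A step that does not change the heap. -/
theorem Sound.skip (HI : HeapInv h g) {p : PC K} (hp : p.Inv h g t) :
    ∃ g', Sound t h g h g' ∧ p.Inv h g' t :=
  ⟨g, .refl HI, hp⟩

theorem Step.sound {σ : EStatus} {p p' : PC K} (s : Step σ t h p h' p') (HI : HeapInv h g)
    (H : p.Inv h g t) : ∃ g', Sound t h g h' g' ∧ p'.Inv h' g' t := by
  have helpSearch : ∀ (m : EMethod) (key1 key2 : K),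
      (PC.helpSearch m key1 key2).Inv h g t := fun m key1 key2 =>
    ⟨rfl, HI.V.head.1, VCont.finds_head HI _ _⟩
  cases s with
  | callAddVertex | callRemoveVertex | response => exact Sound.skip HI trivial
  | callContainsVertex => exact Sound.skip HI ⟨trivial, HI.V.head.1, VCont.finds_head HI _ _⟩
  | callAddEdge | callRemoveEdge | callContainsEdge => exact Sound.skip HI (helpSearch _ _ _)
  | vTest_lt hn hlt => exact Sound.skip HI ⟨H.1, ⟨H.2.1, _, hn, hlt⟩, H.2.2⟩
  | vTest_ge hn hge => exact Sound.skip HI ⟨H.1, ⟨H.2.1, _, hn, hge⟩, H.2.2⟩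
  | vNext hn hw =>
    have hlt := H.2.1.get hn
    refine Sound.skip HI ⟨H.1, (HI.V.next H.2.1.1 hn hw).1, H.2.2.imp fun x n' hx hn' hk _ => ?_⟩
    -- The node `v` has too small a key to be the one sought, so moving on loses nothing.
    rcases hx.cases_head with rfl | ⟨y, hy, hx⟩
    · grind
    · rw [Heap.vnextRel_iff hn, hw] at hy
      cases hy
      exact hx
  | vCheckVal_ne hn hne =>
    refine Sound.skip HI (H.1.notFound (H.2.2.imp fun x n' hx hn' hk _ => ?_))
    have hge := H.2.1.get hn
    rcases HI.V.eq_or_lt hx H.2.1.1 hn hn' with rfl | hlt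
    · grind
    · exact hge (hk ▸ hlt)
  | vCheckVal_eq hn heq =>
    refine Sound.skip HI ⟨_, H.1, ⟨H.2.1.1, _, hn, heq⟩, H.2.2.imp fun x n' hx hn' hk _ => ?_⟩
    have hge := H.2.1.get hn
    rcases HI.V.eq_or_lt hx H.2.1.1 hn hn' with rfl | hlt
    · rfl
    · exact (hge (hk ▸ hlt)).elim
  | vCheckMark_true hn hm =>
    obtain ⟨key, h₁, h₂, h₃⟩ := H
    exact Sound.skip HI (h₁.notFound (h₃.imp fun x n' hx hn' hk hm' => by grind))
  | vCheckMark_false hn hm =>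
    obtain ⟨key, h₁, h₂, h₃⟩ := H
    exact Sound.skip HI (h₁.found h₂ h₃)
  | vlStart hn hw =>
    obtain ⟨h₁, n', hn', hb⟩ := HI.V.head
    exact Sound.skip HI ⟨⟨h₁, n', hn', hb.trans_lt (bot_lt_toVal _)⟩, (HI.V.next h₁ hn hw).1⟩
  | vlTest_lt hn hlt => exact Sound.skip HI ⟨H.2, _, hn, hlt⟩
  | vlTest_ge hn hge => exact Sound.skip HI ⟨H.1, H.2, _, hn, hge⟩
  | vlNext hn hw => exact Sound.skip HI ⟨H, (HI.V.next H.1 hn hw).1⟩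
  | vlAcq1 hn hl =>
    have hg := H.1.get hn
    exact ⟨g, .setV_of_vnext_eq HI hn rfl rfl rfl id H.1.1 (.inl hl),
      .setV_self H.1.1 ⟨hg, rfl⟩, H.2.setV fun h => by
        subst h; have hg := H.2.get hn; exact hg⟩
  | vlAcq2 hn hl =>
    have hg := H.2.get hn
    exact ⟨g, .setV_of_vnext_eq HI hn rfl rfl rfl id H.2.1 (.inl hl),
      H.1.setV fun h => by subst h; have hg := H.1.get hn; exact ⟨hg.1, rfl⟩,
      .setV_self H.2.1 ⟨hg, rfl⟩⟩
  | vlVal1_ok hn hm => exact Sound.skip HI ⟨H.1.imp_of hn fun h => ⟨h.1, h.2, hm⟩, H.2⟩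
  | vlVal2_ok hn hm => exact Sound.skip HI H
  | vlVal3_ok hn hx => exact Sound.skip HI ⟨H.1.imp_of hn fun h => ⟨h.1, h.2.1, h.2.2, hx⟩, H.2⟩
  | vlVal1_fail hn hm =>
    exact Sound.skip HI ⟨H.1.ne H.2 fun _ h h' => h'.1 h.1, H.1.imp fun _ h => h.2,
      H.2.imp fun _ h => h.2⟩
  | vlVal2_fail | vlVal3_fail =>
    exact Sound.skip HI ⟨H.1.ne H.2 fun _ h h' => h'.1 h.1, H.1.imp fun _ h => h.2.1,
      H.2.imp fun _ h => h.2⟩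
  | vaTest_ne hn hne =>
    exact Sound.skip HI ⟨H.1, H.2.imp_of hn fun h => ⟨lt_of_le_of_ne (not_lt.1 h.1) hne.symm, h.2⟩⟩
  | vaTest_eq | vrTest_ne =>
    exact Sound.skip HI ⟨H.1.ne H.2 fun _ h h' => h'.1 h.1, H.1.imp fun _ h => h.2.1,
      H.2.imp fun _ h => h.2⟩
  | vaNew hv heh het hne =>
    refine ⟨_, .newV HI hv heh het hne, _, H.1.newV hv, H.2.newV hv, fun h => ?_, if_pos rfl, _,
      (Heap.newV_vnode _).trans (if_pos rfl), rfl, rfl⟩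
    obtain ⟨n, hn⟩ := HI.V.alloc h
    simp [hv] at hn
  | vaLink hn =>
    obtain ⟨k, h₁, h₂, h₃, h₄, n, hn', h₅, h₆⟩ := H
    cases hn.symm.trans hn'
    exact ⟨g, .setV_link HI hn h₆ h₃ h₄, k, h₁.setV fun h => absurd (h ▸ h₁.1) h₃,
      h₂.setV fun h => absurd (h ▸ h₂.1) h₃, h₃, h₄, _,
      (Heap.setV_vnode ..).trans (if_pos rfl), h₅, rfl⟩
  | vaInsert hn =>
    obtain ⟨k, h₁, ⟨hv₂, n₂, hn₂, hlt, hl₂⟩, h₃, h₄, n, hn', rfl, h₆⟩ := H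
    obtain ⟨hlt', hl, hm, hx⟩ := h₁.get hn
    have hne := VHas.ne_of_vnext HI h₁.1 hn hx
    refine ⟨_, .setV_insert HI h₁.1 hn hl hm hx hn₂ hn' h₆ hlt' hlt h₃ h₄, hne, ?_, ?_⟩
    · exact .setV_self (.inl h₁.1) hl
    · exact ⟨.inl hv₂, n₂, (Heap.setV_vnode ..).trans ((if_neg hne.symm).trans hn₂), hl₂⟩
  | vrTest_eq hn heq =>
    exact Sound.skip HI ⟨H.1.ne H.2 fun _ h h' => h'.1 h.1, H.1.imp fun _ h => ⟨h.2.1, h.2.2.2⟩,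
      H.2.imp fun _ h => h.2⟩
  | vrMark hn =>
    obtain ⟨hne, h₁, h₂⟩ := H
    have hg := h₂.get hn
    exact ⟨g, .setV_of_vnext_eq HI hn rfl rfl rfl (fun _ => rfl) h₂.1 (.inr hg), hne,
      h₁.setV fun h => absurd h hne, .setV_self h₂.1 ⟨hg, rfl⟩⟩
  | vrRead hn =>
    exact Sound.skip HI ⟨H.1, H.2.1, H.2.2.imp_of hn fun h => ⟨h.1, h.2, rfl⟩⟩
  | vrUnlink hn =>
    obtain ⟨hne, h₁, h₂⟩ := H
    obtain ⟨hv₂, n₂, hn₂, hl₂, hm₂, rfl⟩ := h₂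
    exact ⟨g, .setV_unlink HI h₁.1 hn (h₁.get hn).1 (h₁.get hn).2 hn₂ hm₂, hne,
      .setV_self h₁.1 (h₁.get hn).1,
      VHas.setV (P := fun n => n.lock = some t) ⟨hv₂, n₂, hn₂, hl₂⟩ fun h => absurd h hne.symm⟩
  | vRel1 hn =>
    obtain ⟨hne, h₁, h₂⟩ := H
    exact ⟨g, .setV_of_vnext_eq HI hn rfl rfl rfl id h₁.1 (.inr (h₁.get hn)),
      h₂.setV fun h => absurd h hne.symm⟩
  | @vRel2 ρ _ _ hn =>
    refine ⟨g, .setV_of_vnext_eq HI hn rfl rfl rfl id H.1 (.inr (H.get hn)), ?_⟩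
    cases ρ <;> trivial
  | mark1_true | mark2_true => exact Sound.skip HI trivial
  | mark1_false | mark2_false => exact Sound.skip HI H
  | lStart hn =>
    obtain ⟨h₁, m, h₂, h₃⟩ := HI.E.head hn
    exact Sound.skip HI ⟨H, h₁, m, h₂, h₃.trans_lt (bot_lt_toVal _)⟩
  | lFirst hm hx => exact Sound.skip HI ⟨H.1, H.2, (HI.E.next H.2.1 hm hx).1⟩
  | lTest_lt hm hlt => exact Sound.skip HI ⟨H.1, H.2.2, _, hm, hlt⟩
  | lTest_ge hm hge => exact Sound.skip HI ⟨H.1, H.2.1, H.2.2, _, hm, hge⟩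
  | lNext hm hx => exact Sound.skip HI ⟨H.1, H.2, (HI.E.next H.2.1 hm hx).1⟩
  | lAcq1 hm hl =>
    obtain ⟨h₁, h₂, h₃⟩ := H
    have hg := h₂.get hm
    exact ⟨g, .setE_of_enext_eq HI hm rfl rfl id h₂.1 (.inl hl) .inl (fun h h' => absurd h h'),
      h₁.setE hm rfl rfl, .setE_self h₂.1 ⟨hg, rfl⟩,
      h₃.setE fun h => by subst h; have hg := h₃.get hm; exact hg⟩
  | lAcq2 hm hl =>
    obtain ⟨h₁, h₂, h₃⟩ := H
    have hg := h₃.get hm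
    exact ⟨g, .setE_of_enext_eq HI hm rfl rfl id h₃.1 (.inl hl) .inl (fun h h' => absurd h h'),
      h₁.setE hm rfl rfl, h₂.setE fun h => by subst h; have hg := h₂.get hm; exact ⟨hg.1, rfl⟩,
      .setE_self h₃.1 ⟨hg, rfl⟩⟩
  | lVal1_ok hm hs => exact Sound.skip HI ⟨H.1, H.2.1.imp_of hm fun h => ⟨h.1, h.2, hs⟩, H.2.2⟩
  | lVal2_ok hm hs => exact Sound.skip HI ⟨H.1, H.2.1, H.2.2.imp_of hm fun h => ⟨h.1, h.2, hs⟩⟩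
  | lVal1_fail =>
    exact Sound.skip HI ⟨H.1, H.2.1.ne H.2.2 fun _ h h' => h'.1 h.1, _, H.2.1.imp fun _ h => h.2,
      H.2.2.imp fun _ h => h.2⟩
  | lVal2_fail =>
    exact Sound.skip HI ⟨H.1, H.2.1.ne H.2.2 fun _ h h' => h'.1 h.1, _, H.2.1.imp fun _ h => h.2.1,
      H.2.2.imp fun _ h => h.2⟩
  | lVal3_fail =>
    exact Sound.skip HI ⟨H.1, H.2.1.ne H.2.2 fun _ h h' => h'.1 h.1, _, H.2.1.imp fun _ h => h.2.1,
      H.2.2.imp fun _ h => h.2.1⟩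
  | lVal3_ok hm hx =>
    exact Sound.skip HI (H.1.located HI (H.2.1.imp_of hm fun h => ⟨h.1, h.2.1, h.2.2, hx⟩) H.2.2)
  | eRel1 hm =>
    obtain ⟨h₁, hne, v, h₂, h₃⟩ := H
    exact ⟨g, .setE_of_enext_eq HI hm rfl rfl id h₂.1 (.inr (.inl (h₂.get hm))) .inl
      (fun h h' => absurd h h'), h₁.setE hm rfl rfl, v, h₃.setE fun h => absurd h hne.symm⟩
  | @eRel2 ρ e2 m hm =>
    obtain ⟨h₁, v, h₂⟩ := H
    have S := Sound.setE_of_enext_eq (t := t) (m' := { m with lock := none }) HI hm rfl rfl id h₂.1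
      (.inr (.inl (h₂.get hm))) .inl (fun h h' => absurd h h')
    refine ⟨g, S, ?_⟩
    replace h₁ := h₁.setE hm (m' := { m with lock := none }) rfl rfl
    cases ρ with
    | retry κ => exact h₁
    | path c => exact ⟨⟨rfl, h₁⟩, HI.V.head.1, VCont.finds_head S.inv _ _⟩
    | ret => trivial
  | aTest_eq =>
    exact Sound.skip HI ⟨trivial, H.2.1.ne H.2.2 fun _ h h' => h'.1 h.1, _, H.2.1.imp fun _ h => h.2.1,
      H.2.2.imp fun _ h => h.2⟩
  | aTest_ne hm hne =>
    exact Sound.skip HI ⟨H.1, H.2.1,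
      H.2.2.imp_of hm fun h => ⟨lt_of_le_of_ne (not_lt.1 h.1) hne.symm, h.2⟩⟩
  | aNew hm =>
    obtain ⟨h₁, h₂, h₃⟩ := H
    refine ⟨_, .newE HI hm, h₁, h₂.newE hm, h₃.newE hm, ?_, if_pos rfl, _,
      (Heap.setE_enode ..).trans (if_pos rfl), rfl, rfl, rfl⟩
    rw [Option.eq_none_iff_forall_ne_some]
    intro v hv
    obtain ⟨⟨m, hm'⟩, -⟩ := HI.E.alloc hv
    simp [hm] at hm'
  | aLink hm =>
    obtain ⟨h₁, h₂, h₃, h₄, h₅, m, hm', h₆, h₇, h₈⟩ := H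
    cases hm.symm.trans hm'
    exact ⟨g, .setE_link HI hm h₈ h₄ h₅, h₁,
      h₂.setE fun h => absurd (h ▸ h₂.1) (by simp [h₄]),
      h₃.setE fun h => absurd (h ▸ h₃.1) (by simp [h₄]), h₄, h₅, _,
      (Heap.setE_enode ..).trans (if_pos rfl), h₆, h₇, rfl⟩
  | @aInsert c e1 e2 _ hm =>
    obtain ⟨h₁, h₂, h₃, h₄, h₅, m, hm', h₆, h₇, h₈⟩ := H
    obtain ⟨hlt, hl, hs, hx⟩ := h₂.get hm
    obtain ⟨-, m₂, hm₂, hlt₂, -⟩ := id h₃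
    have hne := EHas.ne_of_enext HI h₂.1 hm hx
    -- The new node has no owner yet, whereas its predecessor has one.
    have hne' : c.e3 ≠ e1 := by
      intro h
      rw [h, h₂.1] at h₄
      cases h₄
    exact ⟨_, .setE_insert HI h₁.1 h₂.1 hm hl hs hx hm₂ hm' h₈ (h₆ ▸ hlt) (h₆ ▸ hlt₂) h₇ h₄ h₅,
      ⟨h₁, ⟨if_pos rfl, m, (Heap.setE_enode ..).trans ((if_neg hne').trans hm'), h₆, h₇⟩, h₅⟩,
      hne, c.v1, (EHas.setE_self h₂.1 hl).insertE h₄,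
      ((h₃.imp fun _ h => h.2).setE fun h => absurd h hne.symm).insertE h₄⟩
  | @aAdded c _ hm =>
    obtain ⟨⟨h₁, h₂, h₃⟩, h₄⟩ := H
    obtain ⟨hval, hs⟩ := h₂.get hm
    -- This write is made without a lock. It is covered by the exception for the change from transit
    -- to added, and the verdict `h₄` of `PathExists` is just what the invariant demands.
    refine ⟨g, .setE_of_enext_eq HI hm rfl rfl (fun _ => by simp_all) h₂.1
      (.inr (.inr ⟨rfl, hs, rfl⟩)) (fun _ => .inr h₃) (fun _ _ n k l hn hk hl => ?_), trivial⟩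
    rw [h₁.get hn, toVal_inj] at hk
    rw [hval, toVal_inj] at hl
    rwa [← hk, ← hl]
  | aMark hm =>
    obtain ⟨⟨-, h₁, h₂⟩, rfl, hne, h₃, h₄⟩ := H
    have hg := h₄.get hm
    refine ⟨g, .setE_of_enext_eq HI hm rfl rfl (fun _ => rfl) h₄.1 (.inr (.inl (h₄.get hm)))
      (fun _ => .inr h₂) nofun, hne, _, h₃.setE fun h => absurd h hne,
      .setE_self h₄.1 ⟨hg, rfl, ?_⟩⟩
    rw [(h₁.get hm).1]
    exact toVal_ne_top _
  | rTest_eq hm heq =>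
    obtain ⟨hne, v, h₁, h₂⟩ := H
    exact Sound.skip HI ⟨hne, v, h₁, h₂.imp_of hm fun h => ⟨h.1, h.2, by simp [heq]⟩⟩
  | rTest_ne =>
    obtain ⟨hne, v, h₁, h₂⟩ := H
    exact Sound.skip HI ⟨trivial, hne, v, h₁.imp fun _ h => h.1, h₂.imp fun _ h => h.1⟩
  | rMark hm =>
    obtain ⟨hne, v, h₁, h₂⟩ := H
    obtain ⟨hl, hs, ht⟩ := h₂.get hm
    exact ⟨g, .setE_of_enext_eq HI hm rfl rfl (fun _ => rfl) h₂.1 (.inr (.inl hl))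
      (fun h => by simp [hs] at h) nofun, hne, v, h₁.setE fun h => absurd h hne,
      .setE_self h₂.1 ⟨hl, rfl, ht⟩⟩
  | uRead hm =>
    obtain ⟨hne, v, h₁, h₂⟩ := H
    exact Sound.skip HI ⟨hne, v, h₁, h₂.imp_of hm fun h => ⟨h.1, h.2.1, h.2.2, rfl⟩⟩
  | uWrite hm =>
    obtain ⟨hne, v, h₁, h₂⟩ := H
    obtain ⟨-, m₂, hm₂, hl₂, hs₂, ht₂, rfl⟩ := id h₂
    exact ⟨g, .setE_unlink HI h₁.1 hm (h₁.get hm).1 (h₁.get hm).2 hm₂ hs₂ ht₂, trivial, hne, v,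
      .setE_self h₁.1 (h₁.get hm).1, (h₂.imp fun _ h => h.1).setE fun h => absurd h hne.symm⟩
  | cStart | cTest_lt | cTest_ge | cNext | cCheckVal_ne | cCheckVal_eq | cCheckStatus_ne
  | cCheckStatus_eq => exact Sound.skip HI trivial
  | pStart hn =>
    refine Sound.skip HI ⟨PathCtx.Scan.imp H ?_, _, (HI.E.head hn).1⟩
    rintro _ f m n' l rfl ho hm hl hs hn'
    cases hn.symm.trans hn'
    exact HI.E.reach ho hm hs hn
  | pTest_null hm hx =>
    obtain ⟨H, v, hv⟩ := H
    refine Sound.skip HI (H.imp fun w f m' n l hr ho hm' hl hs hn => ?_)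
    rcases ReflTransGen.cases_head hr with rfl | ⟨y, hy, -⟩
    -- The node with the null pointer has key `⊤` and thus represents no edge.
    · cases hm.symm.trans hm'
      exact top_ne_toVal l ((HI.E.null ho hm hx).symm.trans hl)
    · rw [Heap.enextRel_iff hm, hx] at hy
      cases hy
  | pTest_some | pStatus_ne => exact Sound.skip HI H
  | pStatus_marked hm hs =>
    obtain ⟨H, v, hv⟩ := H
    refine Sound.skip HI ⟨H.imp fun w f m' n l hr ho hm' hl hs' hn => ⟨hr, ?_⟩, v, hv⟩
    rintro rfl
    cases hm.symm.trans hm'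
    exact hs' hs
  | @pVal p kx e m hm =>
    obtain ⟨⟨h₁, h₂, h₃, h₄⟩, v, hv⟩ := H
    -- The node may have been marked since its status was read. A superfluous key is harmless, since
    -- `localR` only has to be large enough.
    refine Sound.skip HI ⟨⟨h₁, h₂, fun k l w f hk he => .inr (h₃ k l w f hk he),
      fun k l w f hk he => ?_⟩, v, hv⟩
    rcases h₄ k l w f hk he with h | h
    · exact .inl (.inr h)
    · by_cases hf : f = e
      · subst hf
        obtain ⟨-, -, -, m', hm', hl, -⟩ := he
        cases hm.symm.trans hm'
        exact .inl (.inl hl.symm)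
      · exact .inr ⟨h, hf⟩
  | pNext hm hx =>
    obtain ⟨H, v, hv⟩ := H
    refine Sound.skip HI ⟨H.imp fun w f m' n l hr ho hm' hl hs' hn => ?_, v, (HI.E.next hv hm hx).1⟩
    rcases ReflTransGen.cases_head hr.1 with h | ⟨y, hy, hr'⟩
    · exact absurd h.symm hr.2
    · rw [Heap.enextRel_iff hm, hx] at hy
      cases hy
      exact hr'
  | pCheck_mem => exact Sound.skip HI H.1
  | pCheck_notMem hk =>
    obtain ⟨h₁, h₂, h₃, h₄⟩ := H
    exact Sound.skip HI ⟨h₁, hk, h₂, h₃.insert fun k l v f hk he => (h₄ k l v f hk he).resolve_right id⟩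
  | pLoop_some => exact Sound.skip HI ⟨⟨rfl, H⟩, HI.V.head.1, VCont.finds_head HI _ _⟩
  | pLoop_none hsub => exact Sound.skip HI ⟨H.1, PathCtx.Inv.not_transGen H hsub⟩

end Steps

/-! ### The invariant along executions, and acyclicity -/

section Executions

variable {K T : Type*} [LinearOrder K]

/-- The history of the initial state. -/
def Ghost.init (T : Type*) : Ghost T where
  clock := 0
  ins _ := 0
  owner e := if e = 0 ∨ e = 1 then some 0 else if e = 2 ∨ e = 3 then some 1 else none
  adder _ := none
  vins v := v = 0 ∨ v = 1
  vadder _ := none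

omit [LinearOrder K] in
theorem initHeap_vnode (σ : EStatus) (v : VRef) : (initHeap K T σ).vnode v =
    if v = 0 then some { val := ⊥, vnext := some 1, edgeHead := 0, edgeTail := 1,
                         marked := false, lock := none }
    else if v = 1 then some { val := ⊤, vnext := none, edgeHead := 2, edgeTail := 3,
                              marked := false, lock := none }
    else none := by
  simp only [initHeap, Heap.setV_vnode, Heap.newV_vnode, vertexHead, vertexTail]
  grind

omit [LinearOrder K] in
theorem initHeap_enode (σ : EStatus) (e : ERef) : (initHeap K T σ).enode e =
    if e = 0 then some { val := ⊥, enext := some 1, status := σ, lock := none }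
    else if e = 1 then some { val := ⊤, enext := none, status := σ, lock := none }
    else if e = 2 then some { val := ⊥, enext := some 3, status := σ, lock := none }
    else if e = 3 then some { val := ⊤, enext := none, status := σ, lock := none }
    else none := by
  simp only [initHeap, Heap.setV_enode]
  rw [Heap.newV_enode, Heap.newV_enode]

theorem HeapInv.init (σ : EStatus) : HeapInv (initHeap K T σ) (Ghost.init T) := by
  have hV := initHeap_vnode (K := K) (T := T) σ
  have hE := initHeap_enode (K := K) (T := T) σ
  have hO : ∀ {e v}, (Ghost.init T).owner e = some v →
      e = 0 ∧ v = 0 ∨ e = 1 ∧ v = 0 ∨ e = 2 ∧ v = 1 ∨ e = 3 ∧ v = 1 := by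
    intro e v he
    simp only [Ghost.init] at he
    grind
  have hv : ∀ {v n}, (initHeap K T σ).vnode v = some n →
      v = 0 ∧ n = { val := ⊥, vnext := some 1, edgeHead := 0, edgeTail := 1,
                    marked := false, lock := none } ∨
      v = 1 ∧ n = { val := ⊤, vnext := none, edgeHead := 2, edgeTail := 3,
                    marked := false, lock := none } := by
    intro v n hn
    rw [hV] at hn
    grind
  -- All edge nodes are sentinels, which makes the clauses about application keys vacuous.
  have hval : ∀ {e m}, (initHeap K T σ).enode e = some m → m.val = ⊥ ∨ m.val = ⊤ := by
    intro e m hm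
    rw [hE] at hm
    grind
  refine ⟨⟨?_, ⟨.inl rfl, ?_⟩, ?_, ?_⟩, ⟨?_, ?_, ?_, ?_, ?_⟩, ?_, fun _ => le_rfl, ?_⟩
  · rintro v (rfl | rfl) <;> simp [hV]
  · simp [hV, vertexHead]
  · intro v n w _ hn hw
    obtain ⟨rfl, rfl⟩ | ⟨rfl, rfl⟩ := hv hn
    · cases hw
      exact ⟨.inr rfl, _, hV 1, bot_lt_top⟩
    · cases hw
  · rintro v n (rfl | rfl) hn hm
    · exact .refl
    · exact .single ⟨_, hV 0, rfl⟩
  · intro e v he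
    rcases hO he with ⟨rfl, rfl⟩ | ⟨rfl, rfl⟩ | ⟨rfl, rfl⟩ | ⟨rfl, rfl⟩ <;> simp [hE, hV]
  · intro v n hn
    obtain ⟨rfl, rfl⟩ | ⟨rfl, rfl⟩ := hv hn <;> simp [Ghost.init, hE]
  · intro e v m f he hm hf
    rcases hO he with ⟨rfl, rfl⟩ | ⟨rfl, rfl⟩ | ⟨rfl, rfl⟩ | ⟨rfl, rfl⟩ <;>
      simp [hE] at hm <;> subst hm <;> simp at hf <;> subst hf <;> simp [Ghost.init, hE]
  · intro e v m he hm hf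
    rcases hO he with ⟨rfl, rfl⟩ | ⟨rfl, rfl⟩ | ⟨rfl, rfl⟩ | ⟨rfl, rfl⟩ <;>
      simp [hE] at hm <;> subst hm <;> simp_all
  · intro e v m n he _ _ hn
    have h₁ : (initHeap K T σ).ENextRel 0 1 := ⟨_, hE 0, rfl⟩
    have h₂ : (initHeap K T σ).ENextRel 2 3 := ⟨_, hE 2, rfl⟩
    rcases hO he with ⟨rfl, rfl⟩ | ⟨rfl, rfl⟩ | ⟨rfl, rfl⟩ | ⟨rfl, rfl⟩ <;>
      simp [hV] at hn <;> subst hn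
    · exact .refl
    · exact .single h₁
    · exact .refl
    · exact .single h₂
  · intro e v m l he hm hl
    have := hval hm
    have := bot_ne_toVal l
    have := top_ne_toVal l
    grind
  · intro e v m l n k he hm hs hl
    have := hval hm
    have := bot_ne_toVal l
    have := top_ne_toVal l
    grind

/-- The history is extended step by step along the execution: the acting thread is treated by
`Step.sound`, all others by `PC.Inv.stable`. -/
theorem State.Reachable.exists_inv [DecidableEq T] {σ : EStatus} {S : State K T}
    (hS : S.Reachable σ) : ∃ g, HeapInv S.heap g ∧ ∀ t, (S.pc t).Inv S.heap g t := by
  induction hS with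
  | refl => exact ⟨Ghost.init T, HeapInv.init σ, fun _ => trivial⟩
  | tail _ hs ih =>
    obtain ⟨g, HI, H⟩ := ih
    obtain ⟨t, p', hstep, hpc⟩ := hs
    obtain ⟨g', hg', hp'⟩ := hstep.sound HI (H t)
    refine ⟨g', hg'.inv, fun u => ?_⟩
    rw [hpc]
    by_cases hu : u = t
    · subst hu
      rwa [Function.update_self]
    · rw [Function.update_of_ne hu]
      exact (H u).stable (hg'.rely u hu) HI

/-- An edge with status `added` that was inserted until time `N`. -/
def IsAddedEdge (h : Heap K T) (g : Ghost T) (N : ℕ) (k l : K) : Prop :=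
  ∃ v f, IsEdgeNode h g N v f k l ∧ ∃ m, h.enode f = some m ∧ m.status = .added

theorem HeapInv.isAddedEdge {h : Heap K T} {g : Ghost T} (H : HeapInv h g) {k l : K}
    (he : h.AddedEdge k l) : IsAddedEdge h g g.clock k l := by
  obtain ⟨-, n, ⟨v, hv, hn, hk, hm⟩, e, m, hr, hem, hl, hs⟩ := he
  have ho := H.E.of_reach hr (H.E.head hn).1
  exact ⟨v, e, ⟨ho, H.clock e, ⟨n, hn, hk, hm⟩, m, hem, hl, by simp [hs]⟩, m, hem, hs⟩

/-- A newest edge of a cycle, say from `x` to `y`, would have a path back from `y` to `x` along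
edges that are not newer, which the invariant forbids. The induction on `N` serves to find a newest
edge. -/
theorem HeapInv.acyclic {h : Heap K T} {g : Ghost T} (H : HeapInv h g) (N : ℕ) (k : K) :
    ¬ TransGen (IsAddedEdge h g N) k k := by
  have step : ∀ N, (∀ k, ¬ TransGen (fun k l => ∃ M < N, IsAddedEdge h g M k l) k k) →
      ∀ k, ¬ TransGen (IsAddedEdge h g N) k k := by
    intro N ih k ht
    have split : ∀ a b, IsAddedEdge h g N a b → (∃ M < N, IsAddedEdge h g M a b) ∨
        ∃ v f m n, g.owner f = some v ∧ g.ins f = N ∧ h.vnode v = some n ∧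
          n.val = toVal a ∧ h.enode f = some m ∧ m.val = toVal b ∧ m.status = .added ∧
          IsEdge h g N a b := by
      rintro a b ⟨v, f, he, m, hm, hs⟩
      rcases he.2.1.lt_or_eq with hlt | heq
      · exact .inl ⟨g.ins f, hlt, v, f, ⟨he.1, le_rfl, he.2.2⟩, m, hm, hs⟩
      · obtain ⟨ho, -, ⟨n, hn, hk, -⟩, m', hm', hl, -⟩ := id he
        cases hm.symm.trans hm'
        exact .inr ⟨v, f, m, n, ho, heq, hn, hk, hm, hl, hs, v, f, he⟩
    rcases transGen_or_exists ht split with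
      hr | ⟨x, y, hkx, ⟨v, f, m, n, h₁, h₂, h₃, h₄, h₅, h₆, h₇, he⟩, hyk⟩
    · exact ih k hr
    · have hle : ∀ a b, IsAddedEdge h g N a b → IsEdge h g N a b :=
        -- The path back consists of added edges, while the invariant excludes even paths with edges
        -- in transit.
        fun _ _ ⟨v, f, he, _⟩ => ⟨v, f, he⟩
      have hyx : ReflTransGen (IsEdge h g N) y x :=
        ReflTransGen.mono hle _ _ (hyk.trans hkx)
      refine H.added h₁ h₅ h₇ h₆ h₃ h₄ ?_
      rw [h₂]
      -- If `y = x`, the edge is a loop and is itself the forbidden path, as its own stamp is within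
      -- the bound.
      rcases reflTransGen_iff_eq_or_transGen.1 hyx with rfl | hyx
      · exact .single he
      · exact hyx
  induction N generalizing k with
  | zero =>
    refine step 0 (fun k ht => ?_) k
    obtain ⟨b, ⟨M, hM, -⟩, -⟩ := TransGen.head'_iff.1 ht
    exact absurd hM (Nat.not_lt_zero M)
  | succ N ih =>
    refine step (N + 1) (fun k ht => ih k (TransGen.mono ?_ _ _ ht)) k
    rintro a b ⟨M, hM, v, f, he, hs⟩
    exact ⟨v, f, he.mono (Nat.lt_succ_iff.1 hM), hs⟩

end Executions

end AcyclicGraph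

/-- Sentinel edge nodes may carry any status `σ` except `marked`. -/
theorem mainTheorem1 {K T : Type*} [LinearOrder K] [DecidableEq T]
    (σ : AcyclicGraph.EStatus) (hσ : σ ≠ AcyclicGraph.EStatus.marked)
    (S : AcyclicGraph.State K T) (hS : AcyclicGraph.State.Reachable σ S) :
    S.AddedAcyclic := by
  obtain ⟨g, H, -⟩ := AcyclicGraph.State.Reachable.exists_inv hS
  exact fun k ht => H.acyclic g.clock k
    (Relation.TransGen.mono (fun _ _ => H.isAddedEdge) _ _ ht)
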